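/- **Setting.** Let $X$ be a measurable space, $Y=\{0,1\}$, and let $\nu$ be a reference measure on $X$. For a measurable set $B\subseteq X$ with $0<\nu(B)<\infty$ the uniform measure on $B$ is $\mu_B(A)=\nu(A\cap B)/\nu(B)$. A perturbation type is a map $\mathcal U:X\to 2^X$; write $\mathcal U\prec\mathcal V$ if $\mathcal U(x)\subseteq\mathcal V(x)$ for all $x$. The adversarial loss is $\ell^{\mathcal U}(h,x,y)=\max_{z\in\mathcal U(x)}\mathbf 1[h(z)\ne y]$ (equal to $0$ if $\mathcal U(x)=\emptyset$), $L^{\mathcal U}_P(h)$ is its expectation under $P$, $L_S^{\mathcal U}(h)$ its average over a sample $S$, and $L^{\mathcal U}_P(\mathcal H)=\inf_{h\in\mathcal H}L^{\mathcal U}_P(h)$. (If a loss set or a failure event is not measurable, its probability is read as outer probability.) A learner $A$ $(\mathcal U,\mathcal V)$-tolerantly PAC learns $\mathcal H$ with $m(\epsilon,\delta)$ samples with respect to a set of distributions on $X\times Y$ if for each such $P$, all $\epsilon,\delta\in(0,1)$ and all $n\ge m(\epsilon,\delta)$, with probability at least $1-\delta$ over $S\sim P^n$ one has $L_P^{\mathcal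 U}(A(S))\le L_P^{\mathcal V}(\mathcal H)+\epsilon$. The agnostic case is that of all probability distributions, the tolerantly realizable case that of all $P$ with $L^{\mathcal V}_P(\mathcal H)=0$. A set $C\subseteq X$ is an $\eta$-net for $\mathcal H$ with respect to $\mu$ if $h^{-1}(y)\cap C\neq\emptyset$ whenever $h\in\mathcal H$, $y\in\{0,1\}$ and $\mu(h^{-1}(y))\ge\eta$. **Hypotheses.** Let $\mathcal H\subseteq\{0,1\}^X$ be a nonempty class of finite VC-dimension that is measurably parametrized: $\mathcal H=\{e(t,\cdot):t\in T\}$ with $T$ a standard Borel space and $e:T\times X\to\{0,1\}$ jointly measurable. Let $0<\eta<1/3$, and let $\mathcal U,\mathcal V,\mathcal W$ be perturbation types such that * all sets $\mathcal V(x)$ and $\mathcal W(x)$ are measurable with $\nu$-measure in $(0,\infty)$, and $x\mapsto\mu_{\mathcal V(x)}(A)$ is measurable for every measurable $A\subseteq X$; * $\mathcal U\prec\mathcal V$, and $\mathcal W(z)\subseteq\mathcal V(x)$ for all $x\in X$ and $z\in\mathcal U(x)$; * $\mu_{\mathcal V(x)}(\mathcal W(z))\ge3\eta$ for all $x\in X$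 and $z\in\mathcal U(x)$. Call a perturbation type $\mathcal C$ *admissible* if $\mathcal C\prec\mathcal V$ and, for all $x$, the set $\mathcal C(x)$ is finite and an $\eta$-net for $\mathcal H$ with respect to $\mu_{\mathcal V(x)}$. RERM-and-Smooth for $\mathcal C$ takes a sample $S$, picks any $\hat h\in\arg\min_{h\in\mathcal H}L_S^{\mathcal C}(h)$ (by an arbitrary selection rule), and outputs the predictor $x\mapsto\mathbf 1\big[\mathbb E_{x'\sim\mu_{\mathcal W(x)}}\hat h(x')\ge 1/2\big]$. **Conclusion.** For every admissible $\mathcal C$, RERM-and-Smooth for $\mathcal C$ $(\mathcal U,\mathcal V)$-tolerantly PAC learns $\mathcal H$, in the tolerantly realizable as well as in the agnostic case, with a sample size that does not depend on the selection rule. Moreover, an admissible $\mathcal C$ can be chosen so that this holds with sample sizes $m(\epsilon,\delta)$ in the tolerantly realizable case and $n(\epsilon,\delta)$ in the agnostic case that satisfy, for all $\epsilon,\delta\in(0,1)$, $$m(\epsilon,\delta)=\tilde O\!\left(\frac{\mathrm{VC}(\mathcal H)\log(\mathrm{VC}(\mathcal H)/\eta)+\log(1/\delta)}{\epsilon}\right),\qquad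 n(\epsilon,\delta)=\tilde O\!\left(\frac{\mathrm{VC}(\mathcal H)\log(\mathrm{VC}(\mathcal H)/\eta)+\log(1/\delta)}{\epsilon^2}\right).$$ Here $0\log 0=0$, and $g=\tilde O(f)$ means $g\le K f\,(1+\log(1+f))^p$ with universal constants $K,p$ that depend on none of the data above. -/

import Mathlib

open MeasureTheory

noncomputable section

namespace TolerantLearning

/-- A perturbation type assigns to every point its set of admissible perturbations. -/
abbrev Perturbation (X : Type*) := X → Set X

/-- A learner maps a finite labelled sample to a predictor. -/
abbrev Learner (X : Type*) := (n : ℕ) → (Fin n → X × Bool) → (X → Bool)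

/-- `U ≺ V`: containment of perturbation types. -/
def Contained {X : Type*} (U V : Perturbation X) : Prop := ∀ x, U x ⊆ V x

/-! ### VC-dimension -/

/-- `H` shatters the finite set `K`: every labelling of `K` is realized by a member of `H`. -/
def Shatters {X : Type*} (H : Set (X → Bool)) (K : Finset X) : Prop :=
  ∀ y : X → Bool, ∃ h ∈ H, ∀ x ∈ K, h x = y x

def vcDim {X : Type*} (H : Set (X → Bool)) : ℕ∞ :=
  ⨆ (K : Finset X) (_ : Shatters H K), (K.card : ℕ∞)

/-- The standard measurability condition on a class: `H` is the family of sections of a jointly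
measurable function `(t, x) ↦ e t x`, with the parameter `t` in a standard Borel space. -/
def MeasurablyParametrized {X : Type*} [MeasurableSpace X] (H : Set (X → Bool)) : Prop :=
  ∃ (T : Type) (_ : MeasurableSpace T) (_ : StandardBorelSpace T) (e : T → X → Bool),
    Measurable (fun q : T × X => e q.1 q.2) ∧ Set.range e = H

/-! ### Adversarial losses -/

open Classical in
/-- The adversarial loss `max_{z ∈ U x} 1[h z ≠ y]`. -/
def advLoss {X : Type*} (U : Perturbation X) (h : X → Bool) (x : X) (y : Bool) : ℝ :=
  if ∃ z ∈ U x, h z ≠ y then 1 else 0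

/-- The expected adversarial loss. The loss is `{0,1}`-valued, so its expectation is the probability
of the loss set (see `risk_eq_integral`); if the loss set is not measurable this is its outer
probability. -/
def risk {X : Type*} [MeasurableSpace X] (U : Perturbation X) (P : Measure (X × Bool))
    (h : X → Bool) : ℝ :=
  P.real {q | advLoss U h q.1 q.2 = 1}

theorem risk_eq_integral {X : Type*} [MeasurableSpace X] (U : Perturbation X)
    (P : Measure (X × Bool)) (h : X → Bool)
    (hm : MeasurableSet {q : X × Bool | advLoss U h q.1 q.2 = 1}) :
    risk U P h = ∫ q, advLoss U h q.1 q.2 ∂P := by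
  have : (fun q : X × Bool => advLoss U h q.1 q.2)
      = Set.indicator {q : X × Bool | advLoss U h q.1 q.2 = 1} 1 := by
    funext q
    by_cases hq : ∃ z ∈ U q.1, h z ≠ q.2
    · simp [advLoss, Set.indicator, hq]
    · simp [advLoss, Set.indicator, hq]
  rw [this, integral_indicator_one hm, risk]

/-- The empirical adversarial loss. -/
def empRisk {X : Type*} (U : Perturbation X) {n : ℕ} (S : Fin n → X × Bool) (h : X → Bool) : ℝ :=
  (1 / (n : ℝ)) * ∑ i, advLoss U h (S i).1 (S i).2

/-- The adversarial approximation error of a class. -/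
def optRisk {X : Type*} [MeasurableSpace X] (V : Perturbation X) (P : Measure (X × Bool))
    (H : Set (X → Bool)) : ℝ :=
  ⨅ h : H, risk V P (h : X → Bool)

/-! ### Tolerant learning -/

/-- `A` tolerantly PAC learns `H` with respect to the set `D` of distributions with `m` samples.
Failure sets that are not measurable are bounded in outer probability. -/
def TolerantlyLearns {X : Type*} [MeasurableSpace X] (U V : Perturbation X) (H : Set (X → Bool))
    (D : Set (Measure (X × Bool))) (A : Learner X) (m : ℝ → ℝ → ℕ) : Prop :=
  ∀ P ∈ D, ∀ ε ∈ Set.Ioo (0 : ℝ) 1, ∀ δ ∈ Set.Ioo (0 : ℝ) 1, ∀ n : ℕ, m ε δ ≤ n →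
    Measure.pi (fun _ : Fin n => P) {S | ¬ risk U P (A n S) ≤ optRisk V P H + ε}
      ≤ ENNReal.ofReal δ

/-- All distributions (agnostic setting). -/
def agnostic (X : Type*) [MeasurableSpace X] : Set (Measure (X × Bool)) :=
  {P | IsProbabilityMeasure P}

/-- The distributions of the tolerantly realizable setting. -/
def realizable {X : Type*} [MeasurableSpace X] (V : Perturbation X) (H : Set (X → Bool)) :
    Set (Measure (X × Bool)) :=
  {P | IsProbabilityMeasure P ∧ optRisk V P H = 0}

/-- `A` is an RERM oracle for `H` and `C`: it returns some minimizer over `H` of the empirical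
adversarial loss with respect to `C`. -/
def IsRERM {X : Type*} (H : Set (X → Bool)) (C : Perturbation X) (A : Learner X) : Prop :=
  ∀ (n : ℕ) (S : Fin n → X × Bool),
    A n S ∈ H ∧ ∀ h ∈ H, empRisk C S (A n S) ≤ empRisk C S h

/-! ### Uniform measures, smoothing and nets -/

/-- `B` carries a uniform measure with respect to the reference measure `ν`
(for instance Lebesgue, Hausdorff or counting measure). -/
def AdmitsUniform {X : Type*} [MeasurableSpace X] (ν : Measure X) (B : Set X) : Prop :=
  MeasurableSet B ∧ ν B ≠ 0 ∧ ν B ≠ ⊤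

/-- The uniform measure on `B`: `A ↦ ν (B ∩ A) / ν B`. -/
def unif {X : Type*} [MeasurableSpace X] (ν : Measure X) (B : Set X) : Measure X :=
  ProbabilityTheory.cond ν B

open Classical in
/-- The `W`-smoothed predictor `x ↦ 1[E_{x' ∼ W x} h x' ≥ 1/2]`. -/
def smooth {X : Type*} [MeasurableSpace X] (ν : Measure X) (W : Perturbation X) (h : X → Bool) :
    X → Bool :=
  fun x => if 1 / 2 ≤ ∫ x', (if h x' = true then (1 : ℝ) else 0) ∂(unif ν (W x)) then true else false

/-- RERM-and-Smooth: run the oracle, then smooth its output. -/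
def rermAndSmooth {X : Type*} [MeasurableSpace X] (ν : Measure X) (W : Perturbation X)
    (A : Learner X) : Learner X :=
  fun n S => smooth ν W (A n S)

/-- `C` is an `η`-net for `H` with respect to `μ`. -/
def IsNet {X : Type*} [MeasurableSpace X] (H : Set (X → Bool)) (μ : Measure X) (η : ℝ)
    (C : Set X) : Prop :=
  ∀ h ∈ H, ∀ y : Bool, η ≤ μ.real (h ⁻¹' {y}) → (h ⁻¹' {y} ∩ C).Nonempty

/-- `C` is a local discretization of `V`: its perturbation sets are finite subsets of those of `V`
that are `η`-nets for the uniform measures. -/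
def IsLocalDiscretization {X : Type*} [MeasurableSpace X] (ν : Measure X) (H : Set (X → Bool))
    (V : Perturbation X) (η : ℝ) (C : Perturbation X) : Prop :=
  Contained C V ∧ ∀ x, (C x).Finite ∧ IsNet H (unif ν (V x)) η (C x)

/-! ### Rates -/

/-- `VC log(VC / η) + log(1 / δ)`; for `d = 0` the first summand is `0`. -/
def complexity (d : ℕ) (η δ : ℝ) : ℝ :=
  (d : ℝ) * Real.log ((d : ℝ) / η) + Real.log (1 / δ)

/-- The bound `K f (1 + log (1 + f)) ^ p`; a quantity is `Õ(f)` if it is bounded in this way with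
constants `K` and `p`. -/
def softBound (K : ℝ) (p : ℕ) (f : ℝ) : ℝ :=
  K * f * (1 + Real.log (1 + f)) ^ p

end TolerantLearning

end

/-! The bridge between the learner's loss and the loss it is judged by is the local error
`localErr`: the mass, under the uniform measure on V(x), of the points that h labels wrongly. If the
smoothed predictor is fooled at some z in U(x), then h errs on at least half of W(z), so the local
error is at least 3η/2 (`le_localErr_of_mem_lossSet`). If the local error is at least η, the net
C(x) contains a wrongly labelled point (`mem_lossSet_of_le_localErr`). Since C ≺ V, the C-loss is in
turn at most the V-loss. So it suffices to bound, uniformly over h, the probability of {local error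
≥ 3η/2} by the frequency of {local error ≥ η}.

The gap between the two thresholds makes this possible without any VC bound for the loss class and
without reference to the size of C(x). On 2n labelled points, an η/4-cover of H in the sum of the 2n
uniform measures yields sets {local error ≥ 5η/4} lying between the two events. Haussler-type
covering numbers (`exists_cover`) bound their number by (48dn/η)^(2d), which produces the term d
log(d/η).

A ghost sample and random swaps then give a relative deviation bound (`measure_exists_relDev_le`).
Level of order ε gives the realizable rate, because there the empirical loss vanishes; level of
order ε² gives the agnostic one. The event in the swapping argument is a union over all of H. It is
null measurable because H is measurably parametrized and projections along a standard Borel space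
are universally measurable (`nullMeasurableSet_exists`). The same deviation bound, applied to H
itself, produces the finite nets. -/

noncomputable section

namespace TolerantLearning

/-! ### Universal measurability of projections -/

section Projection
open Set Filter Topology

/-- In Baire space, a neighbourhood of the box `∏ [0, b i]` contains one of the cylinders over its
finite-dimensional projections. -/
theorem exists_cylinder_subset_of_box_subset {b : ℕ → ℕ} {O : Set (ℕ → ℕ)} (hO : IsOpen O)
    (hb : {α : ℕ → ℕ | ∀ i, α i ≤ b i} ⊆ O) : ∃ k, {α : ℕ → ℕ | ∀ i < k, α i ≤ b i} ⊆ O := by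
  by_contra! hcon
  have hcon' : ∀ k, ∃ α : ℕ → ℕ, (∀ i < k, α i ≤ b i) ∧ α ∉ O := fun k => by
    obtain ⟨α, h1, h2⟩ := Set.not_subset.1 (hcon k)
    exact ⟨α, h1, h2⟩
  choose α hα hαO using hcon'
  have hK : IsCompact {α : ℕ → ℕ | ∀ i, α i ≤ b i} := by
    have : {α : ℕ → ℕ | ∀ i, α i ≤ b i} = Set.pi univ fun i => Iic (b i) := by
      ext; simp [Pi.le_def]
    rw [this]
    exact isCompact_univ_pi fun i => (Set.finite_Iic _).isCompact
  -- Truncation moves the points into the compact box and leaves the first k coordinates of the k-th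
  -- point unchanged, so a limit of the truncated points is also a limit of the original ones.
  obtain ⟨β, hβ, φ, hφ, hlim⟩ := hK.tendsto_subseq (x := fun k i => min (α k i) (b i))
    (fun k i => min_le_right _ _)
  have hlim' : Tendsto (fun k => α (φ k)) atTop (𝓝 β) := by
    rw [tendsto_pi_nhds] at hlim ⊢
    intro i
    refine (hlim i).congr' ?_
    filter_upwards [eventually_gt_atTop i] with k hk
    have := hα (φ k) i (lt_of_lt_of_le hk (hφ.id_le k))
    simp [this]
  obtain ⟨k, hk⟩ := (hlim'.eventually (hO.mem_nhds (hb hβ))).exists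
  exact hαO _ hk

/-- Analytic sets are universally measurable. -/
theorem _root_.MeasureTheory.AnalyticSet.nullMeasurableSet {α : Type*} [TopologicalSpace α]
    [TopologicalSpace.PseudoMetrizableSpace α] [T2Space α] [MeasurableSpace α] [BorelSpace α]
    {s : Set α} (hs : AnalyticSet s) (μ : Measure α) [IsFiniteMeasure μ] :
    NullMeasurableSet s μ := by
  rw [AnalyticSet] at hs
  rcases hs with rfl | ⟨f, hf, rfl⟩
  · exact MeasurableSet.empty.nullMeasurableSet
  have key : ∀ r < μ (range f), ∃ K ⊆ range f, MeasurableSet K ∧ r ≤ μ K := by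
    intro r hr
    -- The images need not be measurable; continuity along increasing unions holds for the outer
    -- measure. Iterating over k bounds all coordinates while the image keeps measure above r.
    have step : ∀ (k : ℕ) (C : {C : Set (ℕ → ℕ) // r < μ (f '' C)}),
        ∃ m : ℕ, r < μ (f '' (C.1 ∩ {α | α k ≤ m})) := by
      intro k C
      have hmono : Monotone fun m : ℕ => f '' (C.1 ∩ {α | α k ≤ m}) := fun m m' h =>
        image_mono (inter_subset_inter_right _ fun α (hα : α k ≤ m) => hα.trans h)
      have hun : ⋃ m : ℕ, f '' (C.1 ∩ {α | α k ≤ m}) = f '' C.1 := by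
        rw [← image_iUnion, ← inter_iUnion, iUnion_eq_univ_iff.2 fun α => ⟨α k, le_refl (α k)⟩,
          inter_univ]
      have := C.2
      rw [← hun, hmono.measure_iUnion] at this
      exact lt_iSup_iff.1 this
    choose m hm using step
    let C : ℕ → {C : Set (ℕ → ℕ) // r < μ (f '' C)} := fun k =>
      Nat.rec ⟨univ, by rwa [image_univ]⟩ (fun k C => ⟨C.1 ∩ {α | α k ≤ m k C}, hm k C⟩) k
    have hC : ∀ k, (C k).1 = {α : ℕ → ℕ | ∀ i < k, α i ≤ m i (C i)} := by
      intro k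
      induction k with
      | zero => ext; simp [C]
      | succ k ih =>
        have : (C (k + 1)).1 = (C k).1 ∩ {α | α k ≤ m k (C k)} := rfl
        rw [this, ih]
        ext α
        simp only [mem_inter_iff, mem_ofPred_eq, Nat.lt_succ_iff_lt_or_eq]
        constructor
        · rintro ⟨h1, h2⟩ i (hi | rfl)
          exacts [h1 i hi, h2]
        · exact fun h => ⟨fun i hi => h i (Or.inl hi), h k (Or.inr rfl)⟩
    set K : Set (ℕ → ℕ) := {α | ∀ i, α i ≤ m i (C i)}
    have hK : IsCompact K := by
      have : K = Set.pi univ fun i => Iic (m i (C i)) := by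
        ext; simp [K, Pi.le_def]
      rw [this]
      exact isCompact_univ_pi fun i => (Set.finite_Iic _).isCompact
    refine ⟨f '' K, image_subset_range _ _, (hK.image hf).isClosed.measurableSet, ?_⟩
    let := TopologicalSpace.pseudoMetrizableSpacePseudoMetric α
    -- The sets C k decrease to K, but continuity from above fails for outer measures. Outer
    -- regularity replaces it: an open set around the image of K already contains the image of some
    -- C k.
    rw [(f '' K).measure_eq_iInf_isOpen]
    refine le_iInf₂ fun U hU => le_iInf fun hUo => ?_
    obtain ⟨k, hk⟩ := exists_cylinder_subset_of_box_subset (hUo.preimage hf) (image_subset_iff.1 hU)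
    rw [← hC] at hk
    exact (C k).2.le.trans (measure_mono (image_subset_iff.2 hk))
  rcases eq_or_ne (μ (range f)) 0 with h0 | h0
  · exact NullMeasurableSet.of_null h0
  obtain ⟨u, -, hu, hulim⟩ := exists_seq_strictMono_tendsto' (pos_iff_ne_zero.2 h0)
  choose K hKs hKm hK using fun n => key (u n) (hu n).2
  have hsub : (⋃ n, K n) ⊆ range f := iUnion_subset hKs
  have hae : (⋃ n, K n) =ᵐ[μ] range f :=
    ae_eq_of_subset_of_measure_ge hsub
      (le_of_tendsto' hulim fun n => (hK n).trans (measure_mono (subset_iUnion _ _)))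
      (MeasurableSet.iUnion hKm).nullMeasurableSet (measure_ne_top _ _)
  exact (MeasurableSet.iUnion hKm).nullMeasurableSet.congr hae

/-- A measurable subset of a product is the preimage of a measurable subset of the product of the
first factor with Cantor space. -/
theorem exists_eq_preimage_cantor {T Ω : Type*} [MeasurableSpace T] [MeasurableSpace Ω]
    {A : Set (T × Ω)} (hA : MeasurableSet A) :
    ∃ φ : Ω → ℕ → Bool, Measurable φ ∧ ∃ A' : Set (T × (ℕ → Bool)), MeasurableSet A' ∧
      Prod.map id φ ⁻¹' A' = A := by
  rw [← generateFrom_prod] at hA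
  induction A, hA using MeasurableSpace.generateFrom_induction with
  | hC A hA _ =>
    obtain ⟨s, hs, t, ht, rfl⟩ := hA
    classical
    refine ⟨fun ω _ => decide (ω ∈ t), measurable_pi_lambda _ fun _ => measurable_to_bool ?_,
      s ×ˢ ((fun y : ℕ → Bool => y 0) ⁻¹' {true}), ?_, ?_⟩
    · convert! (show MeasurableSet t from ht) using 1
      ext; simp
    · exact MeasurableSet.prod hs
        ((measurable_pi_apply (0 : ℕ)) (MeasurableSet.singleton true))
    · ext ⟨x, y⟩; simp
  | empty => exact ⟨fun _ _ => true, measurable_const, ∅, MeasurableSet.empty, rfl⟩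
  | compl A _ h =>
    obtain ⟨φ, hφ, A', hA', rfl⟩ := h
    exact ⟨φ, hφ, A'ᶜ, hA'.compl, rfl⟩
  | iUnion A _ h =>
    choose φ hφ A' hA' h using h
    -- Countably many codes are interleaved into one by the pairing function; `g n` recovers the
    -- n-th.
    let g : ℕ → (ℕ → Bool) → (ℕ → Bool) := fun n y j => y (Nat.pair n j)
    have hg : ∀ n, Measurable (g n) := fun n =>
      measurable_pi_lambda _ fun j => measurable_pi_apply _
    refine ⟨fun ω k => φ k.unpair.1 ω k.unpair.2,
      measurable_pi_lambda _ fun k => (measurable_pi_apply _).comp (hφ _),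
      ⋃ n, Prod.map id (g n) ⁻¹' A' n,
      MeasurableSet.iUnion fun n => (measurable_id.prodMap (hg n)) (hA' n), ?_⟩
    rw [preimage_iUnion]
    refine iUnion_congr fun n => ?_
    rw [← h, ← preimage_comp]
    congr 1
    ext q : 1
    simp [g, Prod.map]

/-- Measurable projection: the projection of a measurable set along a standard Borel space is
universally measurable. -/
theorem nullMeasurableSet_exists {T Ω : Type*} [MeasurableSpace T] [StandardBorelSpace T]
    [MeasurableSpace Ω] {A : Set (T × Ω)} (hA : MeasurableSet A) (μ : Measure Ω)
    [IsFiniteMeasure μ] : NullMeasurableSet {ω | ∃ t, (t, ω) ∈ A} μ := by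
  obtain ⟨φ, hφ, A', hA', rfl⟩ := exists_eq_preimage_cantor hA
  have h1 : AnalyticSet (Prod.snd '' A') := hA'.analyticSet_image measurable_snd
  have h2 := (h1.nullMeasurableSet (μ.map φ)).preimage
    (MeasureTheory.Measure.QuasiMeasurePreserving.mk hφ (Measure.AbsolutelyContinuous.refl _))
  convert h2 using 1
  ext ω
  simp

end Projection

/-! ### Random swaps and relative deviations -/

section RelativeDeviation
open Finset ProbabilityTheory

/-- Hoeffding's inequality for Rademacher sums. -/
theorem card_signs_le {n : ℕ} (a : Fin n → ℝ) {s W : ℝ} (hs : 0 ≤ s) (hW : 0 < W)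
    (ha : ∑ i, a i ^ 2 ≤ W) :
    (#{σ : Fin n → Bool | s ≤ ∑ i, if σ i then -a i else a i} : ℝ)
      ≤ 2 ^ n * Real.exp (-(s ^ 2 / (2 * W))) := by
  -- This minimizes l²W/2 - ls, the exponent in the Chernoff bound.
  set l := s / W
  have hl : 0 ≤ l := by positivity
  have hsum : ∑ σ : Fin n → Bool, Real.exp (l * ∑ i, if σ i then -a i else a i)
      ≤ 2 ^ n * Real.exp (l ^ 2 * W / 2) := by
    have h1 : ∀ σ : Fin n → Bool, Real.exp (l * ∑ i, if σ i then -a i else a i)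
        = ∏ i, Real.exp (l * if σ i then -a i else a i) := fun σ => by
      rw [mul_sum, Real.exp_sum]
    have h2 := prod_univ_sum (fun _ : Fin n => (univ : Finset Bool))
      (fun i b => Real.exp (l * if b then -a i else a i))
    rw [Fintype.piFinset_univ] at h2
    simp_rw [h1]
    rw [← h2]
    calc ∏ i, ∑ b : Bool, Real.exp (l * if b then -a i else a i)
        ≤ ∏ i, 2 * Real.exp ((l * a i) ^ 2 / 2) := by
          refine prod_le_prod (fun i _ => sum_nonneg fun b _ => (Real.exp_pos _).le) fun i _ => ?_
          have := Real.cosh_le_exp_half_sq (l * a i)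
          rw [Real.cosh_eq] at this
          simp
          linarith
      _ = 2 ^ n * Real.exp (l ^ 2 * (∑ i, a i ^ 2) / 2) := by
          rw [prod_mul_distrib, ← Real.exp_sum]
          simp [mul_pow, ← sum_div, mul_sum]
      _ ≤ 2 ^ n * Real.exp (l ^ 2 * W / 2) := by gcongr
  have hmark : (#{σ : Fin n → Bool | s ≤ ∑ i, if σ i then -a i else a i} : ℝ) * Real.exp (l * s)
      ≤ 2 ^ n * Real.exp (l ^ 2 * W / 2) := by
    refine le_trans ?_ hsum
    rw [← nsmul_eq_mul, ← sum_const]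
    refine (sum_le_sum fun σ hσ => ?_).trans
      (sum_le_sum_of_subset_of_nonneg (subset_univ _) fun _ _ _ => (Real.exp_pos _).le)
    simp only [mem_filter] at hσ
    gcongr
    exact hσ.2
  rw [← le_div_iff₀ (Real.exp_pos _), mul_div_assoc, ← Real.exp_sub] at hmark
  refine hmark.trans (le_of_eq ?_)
  congr 2
  simp only [l]
  field_simp
  ring

variable {Z : Type*} {n : ℕ}

/-- The number of points of a sample that lie in a set. -/
def hits (s : Set Z) (x : Fin n → Z) : ℝ := ∑ i, s.indicator (fun _ => (1 : ℝ)) (x i)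

theorem hits_nonneg (s : Set Z) (x : Fin n → Z) : 0 ≤ hits s x :=
  sum_nonneg fun _ _ => Set.indicator_nonneg (fun _ _ => zero_le_one) _

theorem hits_le_hits {s s' : Set Z} {x : Fin n → Z} (h : ∀ i, x i ∈ s → x i ∈ s') :
    hits s x ≤ hits s' x := by
  refine sum_le_sum fun i _ => ?_
  by_cases hi : x i ∈ s
  · simp [hi, h i hi]
  · simpa [hi] using Set.indicator_nonneg (fun _ _ => zero_le_one) _

theorem hits_compl (s : Set Z) (x : Fin n → Z) : hits sᶜ x = n - hits s x := by
  rw [eq_sub_iff_add_eq, hits, hits, ← sum_add_distrib]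
  simp [Set.indicator_compl_add_self_apply]

/-- `u` exceeds `v` by at least `√(κ (u + v))`. -/
def RelDev (κ v u : ℝ) : Prop := v < u ∧ κ * (u + v) ≤ (u - v) ^ 2

/-- Both u - v and (u - v)/(u + v) grow when u increases and v ≥ 0 decreases, hence so does their
product. This is what allows an interpolating set to replace a pair of nested events. -/
theorem RelDev.mono {κ v u v' u' : ℝ} (h : RelDev κ v u) (hv' : 0 ≤ v') (hv : v' ≤ v)
    (hu : u ≤ u') : RelDev κ v' u' := by
  obtain ⟨h1, h2⟩ := h
  refine ⟨by linarith, ?_⟩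
  have hpos : 0 < u + v := by linarith
  have h3 : (u - v) * (u' + v') ≤ (u' - v') * (u + v) := by nlinarith
  have h4 : (u - v) ^ 2 * (u' + v') ≤ (u' - v') ^ 2 * (u + v) := by
    calc (u - v) ^ 2 * (u' + v') = (u - v) * ((u - v) * (u' + v')) := by ring
      _ ≤ (u - v) * ((u' - v') * (u + v)) := mul_le_mul_of_nonneg_left h3 (by linarith)
      _ ≤ (u' - v') * ((u' - v') * (u + v)) := by
          refine mul_le_mul_of_nonneg_right (by linarith) (mul_nonneg (by linarith) hpos.le)
      _ = _ := by ring
  refine le_of_mul_le_mul_right ?_ hpos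
  calc κ * (u' + v') * (u + v) = κ * (u + v) * (u' + v') := by ring
    _ ≤ (u - v) ^ 2 * (u' + v') := mul_le_mul_of_nonneg_right h2 (by linarith)
    _ ≤ _ := h4

/-- Exchange the components of the pairs selected by `σ`. -/
def swapAt (σ : Fin n → Bool) (w : Fin n → Z × Z) : Fin n → Z × Z :=
  fun i => if σ i then (w i).swap else w i

/-- Swaps preserve the total number W of hits in both halves and turn the difference into a
Rademacher sum with coefficients in {-1, 0, 1}, whose squares add up to at most W. Hoeffding's
inequality at √(κW) therefore gives a bound free of W. -/
theorem card_swap_relDev_le (c : Set Z) (w : Fin n → Z × Z) {κ : ℝ} (hκ : 0 ≤ κ) :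
    (Nat.card {σ : Fin n → Bool // RelDev κ (hits c fun i => (swapAt σ w i).1)
      (hits c fun i => (swapAt σ w i).2)} : ℝ) ≤ 2 ^ n * Real.exp (-(κ / 2)) := by
  classical
  set f : Z → ℝ := c.indicator (fun _ => (1 : ℝ))
  set W := ∑ i, (f (w i).2 + f (w i).1)
  have hf : ∀ z, f z = 0 ∨ f z = 1 := fun z => Set.indicator_eq_zero_or_self _ _ z
  have hadd : ∀ σ, (hits c fun i => (swapAt σ w i).2) + (hits c fun i => (swapAt σ w i).1) = W := by
    intro σ
    simp only [hits, ← sum_add_distrib, W]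
    refine sum_congr rfl fun i _ => ?_
    by_cases h : σ i <;> simp [swapAt, h, f, add_comm]
  have hsub : ∀ σ, (hits c fun i => (swapAt σ w i).2) - (hits c fun i => (swapAt σ w i).1)
      = ∑ i, if σ i then -(f (w i).2 - f (w i).1) else f (w i).2 - f (w i).1 := by
    intro σ
    simp only [hits, ← sum_sub_distrib]
    refine sum_congr rfl fun i _ => ?_
    by_cases h : σ i <;> simp [swapAt, h, f]
  have hW0 : 0 ≤ W := sum_nonneg fun i _ => add_nonneg
    (Set.indicator_nonneg (fun _ _ => zero_le_one) _)
    (Set.indicator_nonneg (fun _ _ => zero_le_one) _)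
  rcases hW0.eq_or_lt with hW | hW
  · have : IsEmpty {σ : Fin n → Bool // RelDev κ (hits c fun i => (swapAt σ w i).1)
      (hits c fun i => (swapAt σ w i).2)} := by
      refine ⟨fun ⟨σ, h, _⟩ => ?_⟩
      have h1 := hadd σ
      have h2 := hits_nonneg c fun i => (swapAt σ w i).1
      have h3 := hits_nonneg c fun i => (swapAt σ w i).2
      linarith
    rw [Nat.card_of_isEmpty]
    simp only [Nat.cast_zero]
    positivity
  · have hsq : ∑ i, (f (w i).2 - f (w i).1) ^ 2 ≤ W := by
      refine sum_le_sum fun i _ => ?_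
      rcases hf (w i).2 with h | h <;> rcases hf (w i).1 with h' | h' <;> norm_num [h, h']
    have := card_signs_le (fun i => f (w i).2 - f (w i).1) (Real.sqrt_nonneg (κ * W)) hW hsq
    rw [Real.sq_sqrt (by positivity)] at this
    have he : κ * W / (2 * W) = κ / 2 := by field_simp
    rw [he] at this
    refine le_trans ?_ this
    rw [Nat.card_eq_fintype_card, Fintype.card_subtype]
    norm_cast
    refine card_le_card fun σ hσ => ?_
    simp only [mem_filter, mem_univ, true_and] at hσ ⊢
    rw [← hsub]
    refine Real.sqrt_le_iff.2 ⟨by linarith [hσ.1], ?_⟩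
    rw [← hadd σ]
    exact hσ.2

variable [MeasurableSpace Z]

theorem measurePreserving_swapAt (P : Measure Z) [IsProbabilityMeasure P] (σ : Fin n → Bool) :
    MeasurePreserving (swapAt σ) (Measure.pi fun _ : Fin n => P.prod P)
      (Measure.pi fun _ : Fin n => P.prod P) := by
  refine measurePreserving_pi (f := fun i q => if σ i then Prod.swap q else q) _ _ fun i => ?_
  by_cases h : σ i
  · simp only [h, if_true]
    exact Measure.measurePreserving_swap
  · simp only [h]
    exact MeasurePreserving.id _

/-- An event has probability at most `r` if every point has at most a fraction `r` of its swaps in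
the event. -/
theorem measure_le_of_card_swap_le (P : Measure Z) [IsProbabilityMeasure P]
    {E : Set (Fin n → Z × Z)} (hE : NullMeasurableSet E (Measure.pi fun _ : Fin n => P.prod P))
    {r : ℝ} (h : ∀ w, (Nat.card {σ : Fin n → Bool // swapAt σ w ∈ E} : ℝ) ≤ 2 ^ n * r) :
    (Measure.pi fun _ : Fin n => P.prod P) E ≤ ENNReal.ofReal r := by
  classical
  set μ := Measure.pi fun _ : Fin n => P.prod P
  have hσ : ∀ σ : Fin n → Bool, NullMeasurableSet (swapAt σ ⁻¹' E) μ := fun σ =>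
    hE.preimage (measurePreserving_swapAt P σ).quasiMeasurePreserving
  have h1 : ∑ σ : Fin n → Bool, μ (swapAt σ ⁻¹' E) = 2 ^ n * μ E := by
    rw [sum_congr rfl fun σ _ => (measurePreserving_swapAt P σ).measure_preimage hE]
    simp [μ]
  have h2 : ∑ σ : Fin n → Bool, μ (swapAt σ ⁻¹' E) ≤ ENNReal.ofReal (2 ^ n * r) := by
    calc ∑ σ : Fin n → Bool, μ (swapAt σ ⁻¹' E)
        = ∑ σ : Fin n → Bool, ∫⁻ w, (swapAt σ ⁻¹' E).indicator 1 w ∂μ := by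
          refine sum_congr rfl fun σ _ => ?_
          rw [lintegral_indicator_one₀ (hσ σ)]
      _ = ∫⁻ w, ∑ σ : Fin n → Bool, (swapAt σ ⁻¹' E).indicator 1 w ∂μ := by
          exact (lintegral_finsetSum' _ fun σ _ =>
            (aemeasurable_indicator_const_iff (1 : ENNReal)).2 (hσ σ)).symm
      _ ≤ ∫⁻ _, ENNReal.ofReal (2 ^ n * r) ∂μ := by
          refine lintegral_mono fun w => ?_
          have : ∑ σ : Fin n → Bool, (swapAt σ ⁻¹' E).indicator (1 : (Fin n → Z × Z) → ENNReal) w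
              = (Nat.card {σ : Fin n → Bool // swapAt σ w ∈ E} : ENNReal) := by
            rw [Nat.card_eq_fintype_card, Fintype.card_subtype]
            simp [Set.indicator_apply]
          rw [this, ← ENNReal.ofReal_natCast]
          exact ENNReal.ofReal_le_ofReal (h w)
      _ = _ := by simp
  rw [h1, ENNReal.ofReal_mul (by positivity), ENNReal.ofReal_pow (by norm_num)] at h2
  norm_num at h2
  exact (ENNReal.mul_le_mul_iff_right (by positivity) (by finiteness)).1 h2

end RelativeDeviation

/-! ### Ghost sample and the uniform relative deviation bound -/

section Symmetrization
open Finset ProbabilityTheory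

/-- Markov's inequality for the section measures of a measurable hull of E; passing to the hull
avoids measurability assumptions on B and E. -/
theorem measure_le_two_mul_prod {Ω Ω' : Type*} [MeasurableSpace Ω] [MeasurableSpace Ω']
    (μ : Measure Ω) (ν : Measure Ω') [SFinite ν] {B : Set Ω} {E : Set (Ω × Ω')}
    (h : ∀ x ∈ B, 1 / 2 ≤ ν {y | (x, y) ∈ E}) : μ B ≤ 2 * (μ.prod ν) E := by
  set E' := toMeasurable (μ.prod ν) E
  have hE' : MeasurableSet E' := measurableSet_toMeasurable _ _
  have h1 := mul_meas_ge_le_lintegral (μ := μ) (measurable_measure_prodMk_left (ν := ν) hE') (1 / 2)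
  rw [← Measure.prod_apply hE', measure_toMeasurable] at h1
  have h2 : μ B ≤ μ {x | 1 / 2 ≤ ν (Prod.mk x ⁻¹' E')} :=
    measure_mono fun x hx => (h x hx).trans (measure_mono fun y hy => subset_toMeasurable _ _ hy)
  calc μ B = 2 * (1 / 2 * μ B) := by
        rw [← mul_assoc, one_div, ENNReal.mul_inv_cancel (by norm_num) (by norm_num), one_mul]
    _ ≤ 2 * (μ.prod ν) E := by
        gcongr
        exact le_trans (by gcongr) h1

variable {Z : Type*} {n : ℕ}

theorem measurable_hits {Ω : Type*} [MeasurableSpace Ω] {s : Ω → Set Z} {x : Ω → Fin n → Z}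
    (h : ∀ i, MeasurableSet {ω | x ω i ∈ s ω}) : Measurable fun ω => hits (s ω) (x ω) := by
  refine Finset.measurable_sum _ fun i _ => ?_
  have : (fun ω => (s ω).indicator (fun _ => (1 : ℝ)) (x ω i))
      = {ω | x ω i ∈ s ω}.indicator fun _ => 1 := by
    ext ω
    by_cases hω : x ω i ∈ s ω <;> simp [hω]
  rw [this]
  exact measurable_const.indicator (h i)

variable [MeasurableSpace Z]

/-- With probability at least `1 / 2`, the frequency of a set of probability `p` is at least
`p - s`, provided `n s ^ 2 ≥ 2 p`. -/
theorem half_le_measure_hits (P : Measure Z) [IsProbabilityMeasure P] {A : Set Z}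
    (hA : MeasurableSet A) {s : ℝ} (hs : 0 < s) (hn : 0 < n) (h : 2 * P.real A ≤ n * s ^ 2) :
    1 / 2 ≤ (Measure.pi fun _ : Fin n => P) {x | n * (P.real A - s) ≤ hits A x} := by
  set μ := Measure.pi fun _ : Fin n => P
  set f : Z → ℝ := A.indicator fun _ => 1
  have hf : ∀ z, f z = 0 ∨ f z = 1 := fun z => Set.indicator_eq_zero_or_self _ _ z
  have hfm : Measurable f := measurable_const.indicator hA
  have hfL : MemLp f 2 P := memLp_indicator_const 2 hA 1 (Or.inr (measure_ne_top _ _))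
  have hfi : ∫ z, f z ∂P = P.real A := integral_indicator_one hA
  have hsum : (fun x : Fin n → Z => hits A x) = ∑ i : Fin n, fun x => f (x i) := by
    ext x
    simp [hits, f]
  have hfiL : ∀ i : Fin n, MemLp (fun x : Fin n → Z => f (x i)) 2 μ := fun i =>
    hfL.comp_measurePreserving (measurePreserving_eval (fun _ : Fin n => P) i)
  have hL : MemLp (fun x : Fin n → Z => hits A x) 2 μ := by
    rw [hsum]
    exact memLp_finsetSum' _ fun i _ => hfiL i
  have hE : ∫ x, hits A x ∂μ = n * P.real A := by
    have : ∀ i : Fin n, ∫ x, f (x i) ∂μ = P.real A := fun i => by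
      rw [← hfi]
      exact integral_comp_eval (μ := fun _ : Fin n => P) hfm.aestronglyMeasurable
    simp only [hits]
    rw [integral_finsetSum _ fun i _ => (hfiL i).integrable (by norm_num)]
    rw [Finset.sum_congr rfl fun i _ => this i]
    simp
  have hV : variance (fun x : Fin n → Z => hits A x) μ ≤ n * P.real A := by
    rw [hsum, variance_sum_pi fun _ => hfL]
    have : variance f P ≤ P.real A := by
      refine (variance_le_expectation_sq hfm.aestronglyMeasurable).trans (le_of_eq ?_)
      rw [← hfi]
      refine integral_congr_ae (Filter.Eventually.of_forall fun z => ?_)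
      rcases hf z with h | h <;> simp [h]
    simpa using mul_le_mul_of_nonneg_left this (Nat.cast_nonneg n)
  have hn' : (0 : ℝ) < n := Nat.cast_pos.2 hn
  have hcheb := meas_ge_le_variance_div_sq hL (c := n * s) (by positivity)
  rw [hE] at hcheb
  have hle : μ {x | n * s ≤ |hits A x - n * P.real A|} ≤ 1 / 2 := by
    refine hcheb.trans ?_
    rw [show (1 / 2 : ENNReal) = ENNReal.ofReal (1 / 2) by
      rw [ENNReal.ofReal_div_of_pos (by norm_num)]; norm_num]
    refine ENNReal.ofReal_le_ofReal ?_
    rw [div_le_iff₀ (by positivity)]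
    nlinarith
  have hm : MeasurableSet {x : Fin n → Z | n * s ≤ |hits A x - n * P.real A|} :=
    measurableSet_le measurable_const
      ((measurable_hits fun i => (measurable_pi_apply i) hA).sub_const _).abs
  have hc := prob_compl_eq_one_sub (μ := μ) hm
  calc (1 / 2 : ENNReal) = 1 - 1 / 2 := by norm_num
    _ ≤ 1 - μ {x | n * s ≤ |hits A x - n * P.real A|} := tsub_le_tsub_left hle _
    _ = _ := hc.symm
    _ ≤ _ := by
      refine measure_mono fun x hx => ?_
      simp only [Set.mem_compl_iff, Set.mem_ofPred_eq, not_le] at hx ⊢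
      have := (abs_lt.1 hx).1
      linarith

variable {T : Type*} [MeasurableSpace T] [StandardBorelSpace T]

/-- Uniform relative deviation bound. For two families `a ⊆ b` of events that are jointly measurable
in a standard Borel parameter, and such that on any `2 n` points at most `M` sets suffice to
interpolate between `a` and `b`, it is unlikely that the probability of some `a`-event exceeds the
frequency of the corresponding `b`-event by much. -/
theorem measure_exists_relDev_le (P : Measure Z) [IsProbabilityMeasure P] {a b : Set (T × Z)}
    (ha : MeasurableSet a) (hb : MeasurableSet b) {M τ : ℝ} (hτ : 0 < τ) (hn : 32 / τ ≤ n)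
    (hcover : ∀ K : Finset Z, #K ≤ 2 * n → ∃ F : Finset (Set Z), (#F : ℝ) ≤ M ∧
      ∀ t, ∃ c ∈ F, ∀ z ∈ K, ((t, z) ∈ a → z ∈ c) ∧ (z ∈ c → (t, z) ∈ b)) :
    (Measure.pi fun _ : Fin n => P)
      {S | ∃ t, RelDev τ (hits {z | (t, z) ∈ b} S / n) (P.real {z | (t, z) ∈ a})}
      ≤ ENNReal.ofReal (2 * (M * Real.exp (-(τ * n / 4)))) := by
  classical
  have hn' : (0 : ℝ) < n := lt_of_lt_of_le (by positivity) hn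
  -- The factor n passes from frequencies to counts. The ghost sample keeps 3/4 of the gap, and
  -- (3/4)² ≥ 1/2 explains the loss of a factor 2.
  set κ := τ / 2 * n
  set μ := Measure.pi fun _ : Fin n => P
  set E : Set (Fin n → Z × Z) := {w | ∃ t, RelDev κ (hits {z | (t, z) ∈ b} fun i => (w i).1)
    (hits {z | (t, z) ∈ a} fun i => (w i).2)}
  -- E is a projection along the parameter space; this is where T has to be standard Borel.
  have hEm : NullMeasurableSet E (Measure.pi fun _ : Fin n => P.prod P) := by
    have hu : Measurable fun q : T × (Fin n → Z × Z) =>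
        hits {z | (q.1, z) ∈ a} fun i => (q.2 i).2 :=
      measurable_hits fun i => measurableSet_preimage
        (f := fun q : T × (Fin n → Z × Z) => (q.1, (q.2 i).2)) (by fun_prop) ha
    have hv : Measurable fun q : T × (Fin n → Z × Z) =>
        hits {z | (q.1, z) ∈ b} fun i => (q.2 i).1 :=
      measurable_hits fun i => measurableSet_preimage
        (f := fun q : T × (Fin n → Z × Z) => (q.1, (q.2 i).1)) (by fun_prop) hb
    exact nullMeasurableSet_exists
      ((measurableSet_lt hv hu).inter (measurableSet_le ((hu.add hv).const_mul κ)
        ((hu.sub hv).pow_const 2))) _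
  have hEle : (Measure.pi fun _ : Fin n => P.prod P) E
      ≤ ENNReal.ofReal (M * Real.exp (-(τ * n / 4))) := by
    refine measure_le_of_card_swap_le P hEm fun w => ?_
    obtain ⟨F, hFM, hF⟩ := hcover (univ.image (fun i => (w i).1) ∪ univ.image fun i => (w i).2) (by
      refine (card_union_le _ _).trans ?_
      rw [two_mul]
      exact Nat.add_le_add (card_image_le.trans (by simp)) (card_image_le.trans (by simp)))
    -- Swaps only rearrange the 2n points, so one family F serves all σ in the union bound.
    have hmem : ∀ (σ : Fin n → Bool) i,
        (swapAt σ w i).1 ∈ univ.image (fun i => (w i).1) ∪ univ.image (fun i => (w i).2) ∧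
        (swapAt σ w i).2 ∈ univ.image (fun i => (w i).1) ∪ univ.image (fun i => (w i).2) := by
      intro σ i
      by_cases h : σ i <;> simp [swapAt, h]
    rw [Nat.card_eq_fintype_card, Fintype.card_subtype]
    have hsub : univ.filter (fun σ => swapAt σ w ∈ E) ⊆ F.biUnion fun c =>
        univ.filter fun σ => RelDev κ (hits c fun i => (swapAt σ w i).1)
          (hits c fun i => (swapAt σ w i).2) := by
      intro σ hσ
      simp only [mem_filter, mem_univ, true_and, mem_biUnion] at hσ ⊢
      obtain ⟨t, ht⟩ := hσ
      obtain ⟨c, hc, hcK⟩ := hF t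
      exact ⟨c, hc, ht.mono (hits_nonneg _ _) (hits_le_hits fun i => (hcK _ (hmem σ i).1).2)
        (hits_le_hits fun i => (hcK _ (hmem σ i).2).1)⟩
    calc (#(univ.filter fun σ => swapAt σ w ∈ E) : ℝ)
        ≤ ∑ c ∈ F, (#(univ.filter fun σ => RelDev κ (hits c fun i => (swapAt σ w i).1)
          (hits c fun i => (swapAt σ w i).2)) : ℝ) := by
          exact_mod_cast (card_le_card hsub).trans card_biUnion_le
      _ ≤ ∑ _c ∈ F, 2 ^ n * Real.exp (-(κ / 2)) := by
          refine sum_le_sum fun c _ => ?_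
          have := card_swap_relDev_le c w (κ := κ) (by positivity)
          rwa [Nat.card_eq_fintype_card, Fintype.card_subtype] at this
      _ = #F * (2 ^ n * Real.exp (-(κ / 2))) := by simp
      _ ≤ M * (2 ^ n * Real.exp (-(κ / 2))) := by gcongr
      _ = 2 ^ n * (M * Real.exp (-(τ * n / 4))) := by
          simp only [κ]
          ring_nf
  let e := MeasurableEquiv.arrowProdEquivProdArrow Z Z (Fin n)
  have he := measurePreserving_arrowProdEquivProdArrow Z Z (Fin n) (fun _ => P) (fun _ => P)
  have hprod : (μ.prod μ) (e.symm ⁻¹' E) = (Measure.pi fun _ : Fin n => P.prod P) E :=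
    (he.symm e).measure_preimage hEm
  rw [ENNReal.ofReal_mul (by norm_num), ENNReal.ofReal_ofNat]
  refine (measure_le_two_mul_prod μ μ (E := e.symm ⁻¹' E) ?_).trans (by rw [hprod]; gcongr)
  rintro S ⟨t, h1, h2⟩
  set p := P.real {z | (t, z) ∈ a}
  set v := hits {z | (t, z) ∈ b} S
  have hv : 0 ≤ v / n := div_nonneg (hits_nonneg _ _) hn'.le
  have hp : p ≤ (p + v / n) := by linarith
  have h32 : 32 ≤ n * τ := by rwa [div_le_iff₀ hτ] at hn
  refine (half_le_measure_hits P (A := {z | (t, z) ∈ a})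
    (ha.preimage measurable_prodMk_left) (s := (p - v / n) / 4)
    (by linarith) (Nat.cast_pos.1 hn') ?_).trans (measure_mono fun S' hS' => ⟨t, ?_⟩)
  -- With s a quarter of the gap, n s² ≥ nτ(p + v/n)/16, so nτ ≥ 32 is exactly what the Chebyshev
  -- condition needs.
  · have h3 : 32 * p ≤ n * τ * (p + v / n) :=
      mul_le_mul h32 hp measureReal_nonneg (by positivity)
    change 2 * p ≤ _
    nlinarith [mul_le_mul_of_nonneg_left h2 hn'.le]
  · have h4 : RelDev κ v (n * (p - (p - v / n) / 4)) := by
      have hvn : v = n * (v / n) := by field_simp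
      refine ⟨?_, ?_⟩
      · rw [hvn, mul_lt_mul_iff_right₀ hn']
        have : n * (v / n) / n = v / n := by rw [← hvn]
        rw [this]
        linarith
      · have h5 : τ / 2 * ((p - (p - v / n) / 4) + v / n) ≤ ((p - (p - v / n) / 4) - v / n) ^ 2 := by
          nlinarith
        calc κ * (n * (p - (p - v / n) / 4) + v)
            = n ^ 2 * (τ / 2 * ((p - (p - v / n) / 4) + v / n)) := by
              simp only [κ]; field_simp
          _ ≤ n ^ 2 * ((p - (p - v / n) / 4) - v / n) ^ 2 := by gcongr
          _ = _ := by rw [← mul_pow]; congr 1; field_simp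
    exact h4.mono (hits_nonneg _ _) le_rfl hS'

end Symmetrization

/-! ### Packing and covering numbers of VC classes -/

section Packing
open Finset

theorem sum_range_choose_le (k d : ℕ) : ∑ i ∈ range (d + 1), k.choose i ≤ (k + 1) ^ d := by
  rw [add_pow]
  refine sum_le_sum fun i hi => ?_
  have hid : i ≤ d := Nat.lt_succ_iff.1 (mem_range.1 hi)
  simp only [one_pow, mul_one, Nat.cast_id]
  exact (Nat.choose_le_pow k i).trans (Nat.le_mul_of_pos_right _ (Nat.choose_pos hid))

variable {X : Type*} {H : Set (X → Bool)} {d : ℕ}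

theorem card_le_of_shatters (hH : vcDim H ≤ d) {K : Finset X} (hK : Shatters H K) : #K ≤ d := by
  have : (#K : ℕ∞) ≤ vcDim H :=
    le_iSup₂ (f := fun (K : Finset X) (_ : Shatters H K) => (#K : ℕ∞)) K hK
  exact_mod_cast this.trans hH

/-- Sauer's lemma: a finite subset of a class of VC-dimension `d` whose members are separated by a
finite set `K` has at most `(#K + 1) ^ d` members. -/
theorem card_le_of_separated (hH : vcDim H ≤ d) {F : Finset (X → Bool)} (hF : ∀ f ∈ F, f ∈ H)
    {K : Finset X} (hK : ∀ f ∈ F, ∀ g ∈ F, f ≠ g → ∃ x ∈ K, f x ≠ g x) : #F ≤ (#K + 1) ^ d := by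
  classical
  set 𝒜 : Finset (Finset X) := F.image fun f => K.filter fun x => f x = true
  have hcard : #𝒜 = #F := by
    refine card_image_of_injOn fun f hf g hg h => ?_
    by_contra hne
    obtain ⟨x, hx, hfg⟩ := hK f hf g hg hne
    have h' := Finset.ext_iff.1 h x
    simp only [mem_filter, hx, true_and] at h'
    exact hfg (Bool.eq_iff_iff.2 h')
  -- Sets shattered by the traces are shattered by H, so they have at most d points; Pajor's
  -- inequality bounds the number of traces by the number of such sets.
  have hsub : 𝒜.shatterer ⊆ (range (d + 1)).biUnion fun i => K.powersetCard i := by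
    intro s hs
    rw [mem_shatterer] at hs
    have hsK : s ⊆ K := by
      obtain ⟨u, hu, hsu⟩ := hs (Subset.refl s)
      obtain ⟨f, -, rfl⟩ := mem_image.1 hu
      exact (inter_eq_left.1 hsu).trans (filter_subset _ _)
    have hsH : Shatters H s := by
      intro y
      obtain ⟨u, hu, hsu⟩ := hs (filter_subset (fun x => y x = true) s)
      obtain ⟨f, hf, rfl⟩ := mem_image.1 hu
      refine ⟨f, hF f hf, fun x hx => ?_⟩
      have := Finset.ext_iff.1 hsu x
      simp only [mem_inter, mem_filter, hx, hsK hx, true_and] at this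
      exact Bool.eq_iff_iff.2 this
    simp only [mem_biUnion, mem_range, mem_powersetCard]
    exact ⟨#s, Nat.lt_succ_iff.2 (card_le_of_shatters hH hsH), hsK, rfl⟩
  calc #F = #𝒜 := hcard.symm
    _ ≤ #𝒜.shatterer := card_le_card_shatterer 𝒜
    _ ≤ ∑ i ∈ range (d + 1), #(K.powersetCard i) := (card_le_card hsub).trans card_biUnion_le
    _ ≤ (#K + 1) ^ d := by simpa using sum_range_choose_le #K d

variable [MeasurableSpace X]

theorem measurableSet_ne {f g : X → Bool} (hf : Measurable f) (hg : Measurable g) :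
    MeasurableSet {x | f x ≠ g x} :=
  (measurableSet_eq_fun hf hg).compl

/-- Functions that pairwise differ on sets of measure at least `ρ` can be separated greedily: `k`
points leave at most a fraction `(1 - ρ / m) ^ k` of the pairs unseparated. -/
theorem exists_card_unseparated_le (μ : Measure X) [IsFiniteMeasure μ] {m ρ : ℝ}
    (hm : μ.real Set.univ ≤ m) (hρ : 0 < ρ) (hρm : ρ ≤ m) {F : Finset (X → Bool)}
    (hF : ∀ f ∈ F, Measurable f)
    (hsep : ∀ f ∈ F, ∀ g ∈ F, f ≠ g → ρ ≤ μ.real {x | f x ≠ g x}) (k : ℕ) :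
    ∃ K : Finset X, #K ≤ k ∧
      (Nat.card {q : (X → Bool) × (X → Bool) // q ∈ F.offDiag ∧ ∀ x ∈ K, q.1 x = q.2 x} : ℝ)
        ≤ #F ^ 2 * (1 - ρ / m) ^ k := by
  classical
  have hm0 : 0 < m := hρ.trans_le hρm
  have hr : 0 ≤ 1 - ρ / m := sub_nonneg.2 ((div_le_one hm0).2 hρm)
  have hcard : ∀ K : Finset X,
      Nat.card {q : (X → Bool) × (X → Bool) // q ∈ F.offDiag ∧ ∀ x ∈ K, q.1 x = q.2 x}
        = #(F.offDiag.filter fun q => ∀ x ∈ K, q.1 x = q.2 x) := fun K =>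
    Nat.subtype_card _ (by simp)
  simp only [hcard]
  induction k with
  | zero =>
    refine ⟨∅, le_rfl, ?_⟩
    simp only [notMem_empty, false_imp_iff, implies_true, filter_true, pow_zero, mul_one]
    rw [offDiag_card, sq]
    exact_mod_cast Nat.sub_le _ _
  | succ k ih =>
    obtain ⟨K, hK, hQ⟩ := ih
    set Q := F.offDiag.filter fun q => ∀ x ∈ K, q.1 x = q.2 x
    rcases Q.eq_empty_or_nonempty with hQ0 | ⟨q₀, hq₀⟩
    · refine ⟨K, by lia, ?_⟩
      change (#Q : ℝ) ≤ _
      rw [hQ0]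
      simp only [card_empty, Nat.cast_zero]
      positivity
    have hQF : ∀ q ∈ Q, q.1 ∈ F ∧ q.2 ∈ F ∧ q.1 ≠ q.2 := fun q hq =>
      mem_offDiag.1 (mem_filter.1 hq).1
    have hQm : ∀ q ∈ Q, MeasurableSet {x | q.1 x ≠ q.2 x} := fun q hq =>
      measurableSet_ne (hF _ (hQF q hq).1) (hF _ (hQF q hq).2.1)
    have hQρ : ∀ q ∈ Q, ρ ≤ μ.real {x | q.1 x ≠ q.2 x} := fun q hq =>
      hsep _ (hQF q hq).1 _ (hQF q hq).2.1 (hQF q hq).2.2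
    have hpos : 0 < μ.real Set.univ :=
      hρ.trans_le ((hQρ _ hq₀).trans (measureReal_mono (Set.subset_univ _)))
    have hμ : μ ≠ 0 := by
      rintro rfl
      simp at hpos
    set N : X → ℝ := fun x => ∑ q ∈ Q, {x | q.1 x ≠ q.2 x}.indicator (fun _ => (1 : ℝ)) x
    have hNi : ∀ q ∈ Q, Integrable ({x | q.1 x ≠ q.2 x}.indicator fun _ => (1 : ℝ)) μ :=
      fun q hq => (integrable_const 1).indicator (hQm q hq)
    -- Some point separates at least the average number of remaining pairs, and that average is at
    -- least `#Q * (ρ / m)`.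
    obtain ⟨x, hx⟩ := exists_average_le hμ (integrable_finsetSum Q hNi)
    have hint : (#Q : ℝ) * ρ ≤ ∫ x, N x ∂μ := by
      rw [integral_finsetSum _ hNi, ← nsmul_eq_mul, ← sum_const]
      refine sum_le_sum fun q hq => (hQρ q hq).trans (le_of_eq ?_)
      exact (integral_indicator_one (hQm q hq)).symm
    have hNx : (#Q : ℝ) * (ρ / m) ≤ N x := by
      refine le_trans ?_ hx
      rw [average_eq, smul_eq_mul, mul_comm _ (∫ x, _ ∂μ), ← mul_div_assoc, div_eq_mul_inv]
      refine mul_le_mul hint ?_ (by positivity) ((by positivity : 0 ≤ (#Q : ℝ) * ρ).trans hint)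
      gcongr
    have hNc : N x = #(Q.filter fun q => q.1 x ≠ q.2 x) := by
      rw [card_filter]
      push_cast
      refine sum_congr rfl fun q _ => ?_
      by_cases hq : q.1 x = q.2 x <;> simp [hq]
    have hsplit := card_filter_add_card_filter_not (s := Q) (fun q => q.1 x ≠ q.2 x)
    refine ⟨insert x K, (card_insert_le _ _).trans (by lia), ?_⟩
    have hnew : F.offDiag.filter (fun q => ∀ z ∈ insert x K, q.1 z = q.2 z)
        = Q.filter fun q => ¬ q.1 x ≠ q.2 x := by
      ext q
      simp only [Q, mem_filter, mem_insert, forall_eq_or_imp, not_not]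
      tauto
    rw [hnew]
    have hsplit' : (#(Q.filter fun q => ¬ q.1 x ≠ q.2 x) : ℝ) = #Q - N x := by
      rw [hNc, ← hsplit]
      push_cast
      ring
    rw [hsplit', pow_succ (1 - ρ / m), ← mul_assoc]
    calc (#Q : ℝ) - N x ≤ #Q * (1 - ρ / m) := by linarith
      _ ≤ _ := mul_le_mul_of_nonneg_right hQ hr

/-- A bound for the packing numbers of a class of VC-dimension `d`. -/
theorem card_packing_le (hH : vcDim H ≤ d) (hd : d ≠ 0) (μ : Measure X) [IsFiniteMeasure μ]
    {m ρ : ℝ} (hm : μ.real Set.univ ≤ m) (hρ : 0 < ρ) (hρm : ρ ≤ m) {F : Finset (X → Bool)}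
    (hFH : ∀ f ∈ F, f ∈ H) (hF : ∀ f ∈ F, Measurable f)
    (hsep : ∀ f ∈ F, ∀ g ∈ F, f ≠ g → ρ ≤ μ.real {x | f x ≠ g x}) :
    (#F : ℝ) ≤ (6 * d * m / ρ) ^ (2 * d) := by
  have hm0 : 0 < m := hρ.trans_le hρm
  rcases Nat.eq_zero_or_pos #F with h0 | hN
  · rw [h0]
    simp only [Nat.cast_zero]
    positivity
  set r := ρ / m
  have hr : 0 < r := by positivity
  have hr1 : r ≤ 1 := (div_le_one hm0).2 hρm
  have hN1 : (1 : ℝ) ≤ #F := by exact_mod_cast hN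
  have hd1 : (1 : ℝ) ≤ d := by exact_mod_cast Nat.one_le_iff_ne_zero.2 hd
  -- Just large enough that fewer than one pair, hence none, stays unseparated.
  set k := ⌊2 * Real.log #F / r⌋₊ + 1
  have hk : 2 * Real.log #F < r * k := by
    have := Nat.lt_floor_add_one (2 * Real.log #F / r)
    rw [div_lt_iff₀ hr] at this
    simpa [k, mul_comm] using this
  have hk' : (k : ℝ) + 1 ≤ 2 * Real.log #F / r + 2 := by
    have := Nat.floor_le (a := 2 * Real.log #F / r) (by have := Real.log_nonneg hN1; positivity)
    simp only [k]
    push_cast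
    linarith
  obtain ⟨K, hK, hcard⟩ := exists_card_unseparated_le μ hm hρ hρm hF hsep k
  have hlt : (#F : ℝ) ^ 2 * (1 - ρ / m) ^ k < 1 := by
    calc (#F : ℝ) ^ 2 * (1 - r) ^ k ≤ Real.exp (2 * Real.log #F) * Real.exp (-r) ^ k := by
          refine mul_le_mul (le_of_eq ?_)
            (pow_le_pow_left₀ (by linarith) (Real.one_sub_le_exp_neg r) k)
            (pow_nonneg (by linarith) k) (Real.exp_pos _).le
          rw [mul_comm, Real.exp_mul, Real.exp_log (by linarith)]
          norm_cast
      _ = Real.exp (2 * Real.log #F - r * k) := by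
          rw [← Real.exp_nat_mul, ← Real.exp_add]
          congr 1
          ring
      _ < 1 := by rw [← Real.exp_zero]; exact Real.exp_lt_exp.2 (by linarith)
  have hzero : Nat.card {q : (X → Bool) × (X → Bool) // q ∈ F.offDiag ∧ ∀ x ∈ K, q.1 x = q.2 x}
      = 0 := by
    have := hcard.trans_lt hlt
    exact Nat.lt_one_iff.1 (by exact_mod_cast this)
  have hempty : ∀ f ∈ F, ∀ g ∈ F, f ≠ g → ∃ x ∈ K, f x ≠ g x := by
    intro f hf g hg hne
    by_contra! hcon
    have hfin : Finite {q : (X → Bool) × (X → Bool) // q ∈ F.offDiag ∧ ∀ x ∈ K, q.1 x = q.2 x} :=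
      Set.Finite.subset (F.offDiag.finite_toSet) fun q hq => hq.1
    have := (Finite.card_eq_zero_iff.1 hzero)
    exact this.false ⟨(f, g), mem_offDiag.2 ⟨hf, hg, hne⟩, hcon⟩
  have hsauer : (#F : ℝ) ≤ (k + 1) ^ d := by
    have h1 := card_le_of_separated hH hFH hempty
    calc (#F : ℝ) ≤ (#K + 1) ^ d := by exact_mod_cast h1
      _ ≤ (k + 1) ^ d := by gcongr
  -- Sauer's lemma bounds `#F` by a power of its own logarithm. From log `#F` ≤ 2dy follows k + 1 ≤
  -- (6d/r)y, so y^(2d) ≤ (6d/r)^d y^d, and y^d cancels.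
  set y : ℝ := (#F : ℝ) ^ (1 / (2 * d : ℝ))
  have hy1 : 1 ≤ y := Real.one_le_rpow hN1 (by positivity)
  have hyN : y ^ (2 * d) = #F := by
    rw [← Real.rpow_natCast, ← Real.rpow_mul (by positivity)]
    push_cast
    rw [one_div, inv_mul_cancel₀ (by positivity), Real.rpow_one]
  have hlog : Real.log #F ≤ 2 * d * y := by
    have := Real.log_le_rpow_div (x := (#F : ℝ)) (by positivity)
      (ε := 1 / (2 * d : ℝ)) (by positivity)
    rwa [div_div_eq_mul_div, div_one, mul_comm] at this
  have hky : (k : ℝ) + 1 ≤ 6 * d / r * y := by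
    have h1 : 2 * Real.log #F / r ≤ 4 * d / r * y := by
      rw [div_mul_eq_mul_div]
      exact div_le_div_of_nonneg_right (by linarith) hr.le
    have h2 : (2 : ℝ) ≤ 2 * d / r * y := by
      have h3 : 1 ≤ d / r := by rw [le_div_iff₀ hr]; linarith
      have : 2 * d / r * y = 2 * (d / r * y) := by ring
      rw [this]
      nlinarith
    have h3 : 6 * d / r * y = 4 * d / r * y + 2 * d / r * y := by ring
    linarith
  have hyd : y ^ d ≤ (6 * d / r) ^ d := by
    have h1 : y ^ d * y ^ d ≤ (6 * d / r) ^ d * y ^ d := by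
      calc y ^ d * y ^ d = #F := by rw [← pow_add, ← two_mul, hyN]
        _ ≤ (k + 1) ^ d := hsauer
        _ ≤ (6 * d / r * y) ^ d := by gcongr
        _ = _ := mul_pow _ _ _
    exact le_of_mul_le_mul_right h1 (by positivity)
  calc (#F : ℝ) = (y ^ d) ^ 2 := by rw [← hyN, ← pow_mul, mul_comm]
    _ ≤ ((6 * d / r) ^ d) ^ 2 := by gcongr
    _ = (6 * d * m / ρ) ^ (2 * d) := by
        rw [← pow_mul, mul_comm d]
        congr 1
        simp only [r]
        field_simp

/-- A bound for the covering numbers of a class of VC-dimension `d`. -/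
theorem exists_cover (hH : vcDim H ≤ d) (hd : d ≠ 0) (hHm : ∀ h ∈ H, Measurable h)
    (μ : Measure X) [IsFiniteMeasure μ] {m ρ : ℝ} (hm : μ.real Set.univ ≤ m) (hρ : 0 < ρ)
    (hρm : ρ ≤ m) :
    ∃ F : Finset (X → Bool), (#F : ℝ) ≤ (6 * d * m / ρ) ^ (2 * d) ∧
      ∀ h ∈ H, ∃ f ∈ F, μ.real {x | h x ≠ f x} < ρ := by
  classical
  let p : Finset (X → Bool) → Prop := fun F =>
    (∀ f ∈ F, f ∈ H) ∧ ∀ f ∈ F, ∀ g ∈ F, f ≠ g → ρ ≤ μ.real {x | f x ≠ g x}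
  have hp : ∀ F, p F → (#F : ℝ) ≤ (6 * d * m / ρ) ^ (2 * d) := fun F hF =>
    card_packing_le hH hd μ hm hρ hρm hF.1 (fun f hf => hHm f (hF.1 f hf)) hF.2
  have hbdd : BddAbove {N | ∃ F, p F ∧ #F = N} := by
    refine ⟨⌈(6 * d * m / ρ) ^ (2 * d)⌉₊, ?_⟩
    rintro _ ⟨F, hF, rfl⟩
    exact_mod_cast (hp F hF).trans (Nat.le_ceil _)
  have hne : {N | ∃ F, p F ∧ #F = N}.Nonempty := ⟨0, ∅, by simp [p], rfl⟩
  -- A packing of maximal size is a cover, since an uncovered member of H could be added to it.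
  obtain ⟨F, hF, hmax⟩ := Nat.sSup_mem hne hbdd
  refine ⟨F, hp F hF, fun h hh => ?_⟩
  by_contra! hcon
  have hnot : h ∉ F := fun hmem => by
    have := hcon h hmem
    simp at this
    linarith
  have hins : p (insert h F) := by
    refine ⟨fun f hf => (mem_insert.1 hf).elim (fun e => e ▸ hh) (hF.1 f), ?_⟩
    intro f hf g hg hne
    rcases mem_insert.1 hf with hfh | hfF <;> rcases mem_insert.1 hg with hgh | hgF
    · exact absurd (hfh.trans hgh.symm) hne
    · exact hfh ▸ hcon g hgF
    · rw [hgh]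
      simpa only [ne_comm] using hcon f hfF
    · exact hF.2 f hfF g hgF hne
  have := le_csSup hbdd ⟨insert h F, hins, rfl⟩
  rw [card_insert_of_notMem hnot, ← hmax] at this
  lia

/-- Covering numbers with respect to finitely many probability measures at once. -/
theorem exists_cover_family (hH : vcDim H ≤ d) (hd : d ≠ 0) (hHm : ∀ h ∈ H, Measurable h)
    {ι : Type*} (κ : ι → Measure X) [∀ i, IsProbabilityMeasure (κ i)] (K : Finset ι) {m ρ : ℝ}
    (hm : #K ≤ m) (hρ : 0 < ρ) (hρm : ρ ≤ m) :
    ∃ F : Finset (X → Bool), (#F : ℝ) ≤ (6 * d * m / ρ) ^ (2 * d) ∧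
      ∀ h ∈ H, ∃ f ∈ F, ∀ i ∈ K, (κ i).real {x | h x ≠ f x} < ρ := by
  have hfin : IsFiniteMeasure (∑ i ∈ K, κ i) := ⟨by simp [Measure.finsetSum_apply]⟩
  -- The sum dominates each summand, and its total mass `#K` enters the covering number only through
  -- m.
  obtain ⟨F, hF, hcov⟩ := exists_cover hH hd hHm (∑ i ∈ K, κ i) (m := m) (ρ := ρ)
    (by simpa [measureReal_def, Measure.finsetSum_apply] using hm) hρ hρm
  refine ⟨F, hF, fun h hh => ?_⟩
  obtain ⟨f, hf, hlt⟩ := hcov h hh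
  refine ⟨f, hf, fun i hi => lt_of_le_of_lt ?_ hlt⟩
  refine ENNReal.toReal_mono (measure_ne_top _ _) ?_
  rw [Measure.finsetSum_apply]
  exact single_le_sum (f := fun i => κ i {x | h x ≠ f x}) (fun _ _ => zero_le) hi

end Packing

/-! ### Existence of finite nets -/

section Nets
open Finset Filter Topology

variable {X T : Type*} [MeasurableSpace X] [MeasurableSpace T]

theorem exists_nat_pow_mul_exp_lt_one (A : ℝ) (j : ℕ) {η : ℝ} (hη : 0 < η) (b : ℝ) :
    ∃ n : ℕ, b ≤ n ∧ 2 * ((A * n) ^ j * Real.exp (-(η * n / 4))) < 1 := by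
  have hlim : Tendsto (fun n : ℕ => η / 4 * (n : ℝ)) atTop atTop :=
    tendsto_natCast_atTop_atTop.const_mul_atTop (by positivity)
  have h1 := ((Real.tendsto_pow_mul_exp_neg_atTop_nhds_zero j).comp hlim).const_mul
    (2 * (A * (4 / η)) ^ j)
  rw [mul_zero] at h1
  obtain ⟨n, hn1, hn2⟩ := ((h1.eventually_lt_const one_pos).and
    (tendsto_natCast_atTop_atTop.eventually_ge_atTop b)).exists
  refine ⟨n, hn2, lt_of_eq_of_lt ?_ hn1⟩
  simp only [Function.comp_apply]
  rw [show A * n = A * (4 / η) * (η / 4 * n) by field_simp, mul_pow,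
    show η / 4 * (n : ℝ) = η * n / 4 by ring]
  ring

variable {e : T → X → Bool} {d : ℕ}

theorem measurable_section (he : Measurable fun q : T × X => e q.1 q.2) :
    ∀ h ∈ Set.range e, Measurable h := by
  rintro _ ⟨t, rfl⟩
  exact he.comp measurable_prodMk_left

variable [StandardBorelSpace T]

/-- Classes of finite VC-dimension have finite nets. -/
theorem exists_finite_hitting (he : Measurable fun q : T × X => e q.1 q.2)
    (hH : vcDim (Set.range e) ≤ d) (μ : Measure X) [IsProbabilityMeasure μ] {B : Set X}
    (hB : ∀ᵐ x ∂μ, x ∈ B) {η : ℝ} (hη : 0 < η) (y : Bool) :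
    ∃ C ⊆ B, C.Finite ∧ ∀ h ∈ Set.range e, η ≤ μ.real (h ⁻¹' {y}) → (h ⁻¹' {y} ∩ C).Nonempty := by
  classical
  -- The covering bound needs a nonzero dimension, and no rate is required here.
  have hH' : vcDim (Set.range e) ≤ (d + 1 : ℕ) := hH.trans (by exact_mod_cast Nat.le_succ d)
  obtain ⟨n, hn, hexp⟩ := exists_nat_pow_mul_exp_lt_one (24 * (d + 1 : ℕ)) (2 * (d + 1)) hη
    (max (32 / η) 1)
  have hn1 : (1 : ℝ) ≤ n := (le_max_right _ _).trans hn
  have ha : MeasurableSet {q : T × X | e q.1 q.2 = y} := he (MeasurableSet.singleton y)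
  have hdev := measure_exists_relDev_le μ ha ha hη ((le_max_left _ _).trans hn)
    (M := (24 * (d + 1 : ℕ) * n) ^ (2 * (d + 1))) (by
      intro K hK
      have hK' : (#K : ℝ) ≤ 2 * n := by exact_mod_cast hK
      -- For Dirac measures, distance below 1/2 means agreement at the point, so F realizes all
      -- traces of the class on K.
      obtain ⟨F, hF, hcov⟩ := exists_cover_family hH' d.succ_ne_zero (measurable_section he)
        (fun x : X => Measure.dirac x) K (ρ := 1 / 2) hK' (by norm_num) (by linarith)
      refine ⟨F.image fun f => {x | f x = y}, ?_, fun t => ?_⟩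
      · refine (Nat.cast_le.2 card_image_le).trans (hF.trans (le_of_eq ?_))
        congr 1
        ring
      · obtain ⟨f, hf, hfK⟩ := hcov _ ⟨t, rfl⟩
        refine ⟨_, mem_image_of_mem _ hf, fun x hx => ?_⟩
        have hxf : e t x = f x := by
          by_contra hne
          have h1 := hfK x hx
          have h2 : Measure.dirac x {z | e t z ≠ f z} = 1 :=
            Measure.dirac_apply_of_mem (a := x) (s := {z | e t z ≠ f z}) hne
          rw [measureReal_def, h2] at h1
          norm_num at h1
        simp [hxf])
  have hdev' := hdev.trans_lt (ENNReal.ofReal_lt_one.2 hexp)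
  have hBn : ∀ᵐ S ∂Measure.pi fun _ : Fin n => μ, ∀ i, S i ∈ B := ae_all_iff.2 fun i =>
    (measurePreserving_eval (fun _ : Fin n => μ) i).quasiMeasurePreserving.ae hB
  -- Deviation has probability below 1 and the sample lies in B almost surely. Any sample without
  -- deviation is a net, because missing a set of measure p ≥ η would be a deviation from frequency
  -- 0.
  obtain ⟨S, hSB, hS⟩ : ∃ S : Fin n → X, (∀ i, S i ∈ B) ∧
      ¬ ∃ t, RelDev η (hits {x | (t, x) ∈ {q : T × X | e q.1 q.2 = y}} S / n)
        (μ.real {x | (t, x) ∈ {q : T × X | e q.1 q.2 = y}}) := by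
    by_contra! hcon
    refine hdev'.not_ge ?_
    rw [← measure_univ (μ := Measure.pi fun _ : Fin n => μ)]
    exact measure_mono_ae (hBn.mono fun S hS _ => hcon S hS)
  refine ⟨Set.range S, Set.range_subset_iff.2 hSB, Set.finite_range S, ?_⟩
  rintro _ ⟨t, rfl⟩ hη'
  by_contra hcon
  refine hS ⟨t, ?_⟩
  have hzero : hits {x | (t, x) ∈ {q : T × X | e q.1 q.2 = y}} S = 0 := by
    refine sum_eq_zero fun i _ => Set.indicator_of_notMem (fun hi => hcon ?_) _
    exact ⟨S i, hi, i, rfl⟩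
  rw [hzero, zero_div]
  change η ≤ μ.real {x | (t, x) ∈ {q : T × X | e q.1 q.2 = y}} at hη'
  refine ⟨hη.trans_le hη', ?_⟩
  rw [add_zero, sub_zero, sq]
  exact mul_le_mul_of_nonneg_right hη' measureReal_nonneg

theorem isProbabilityMeasure_unif {ν : Measure X} {B : Set X} (hB : AdmitsUniform ν B) :
    IsProbabilityMeasure (unif ν B) :=
  ProbabilityTheory.cond_isProbabilityMeasure_of_finite hB.2.1 hB.2.2

/-- The nets are chosen separately for each point and label; no measurable dependence on the point
is needed, since the deviation bound never involves C. -/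
theorem exists_isLocalDiscretization (he : Measurable fun q : T × X => e q.1 q.2)
    (hH : vcDim (Set.range e) ≤ d) {ν : Measure X} {V : Perturbation X}
    (hV : ∀ x, AdmitsUniform ν (V x)) {η : ℝ} (hη : 0 < η) :
    ∃ C, IsLocalDiscretization ν (Set.range e) V η C := by
  have key : ∀ x y, ∃ C ⊆ V x, C.Finite ∧ ∀ h ∈ Set.range e,
      η ≤ (unif ν (V x)).real (h ⁻¹' {y}) → (h ⁻¹' {y} ∩ C).Nonempty := fun x y => by
    have := isProbabilityMeasure_unif (hV x)
    exact exists_finite_hitting he hH (unif ν (V x)) (ProbabilityTheory.ae_cond_mem (hV x).1) hη y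
  choose C hCV hCf hC using key
  refine ⟨fun x => ⋃ y, C x y, fun x => Set.iUnion_subset (hCV x), fun x =>
    ⟨Set.finite_iUnion (hCf x), fun h hh y hy => ?_⟩⟩
  exact (hC x y h hh hy).mono (Set.inter_subset_inter_right _ (Set.subset_iUnion _ y))

end Nets

/-! ### Local errors between the smoothed loss and the discretized loss -/

section Losses
open Finset

variable {X : Type*}

/-- The labelled points on which the adversarial loss is `1`. -/
def lossSet (U : Perturbation X) (h : X → Bool) : Set (X × Bool) := {q | advLoss U h q.1 q.2 = 1}

theorem mem_lossSet {U : Perturbation X} {h : X → Bool} {q : X × Bool} :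
    q ∈ lossSet U h ↔ ∃ z ∈ U q.1, h z ≠ q.2 := by
  simp only [lossSet, Set.mem_ofPred_eq, advLoss]
  split_ifs with hq <;> simp [hq]

theorem lossSet_mono {U V : Perturbation X} (hUV : Contained U V) (h : X → Bool) :
    lossSet U h ⊆ lossSet V h := fun q hq => by
  obtain ⟨z, hz, hne⟩ := mem_lossSet.1 hq
  exact mem_lossSet.2 ⟨z, hUV _ hz, hne⟩

theorem empRisk_eq_hits (U : Perturbation X) {n : ℕ} (S : Fin n → X × Bool) (h : X → Bool) :
    empRisk U S h = hits (lossSet U h) S / n := by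
  rw [empRisk, hits, one_div, inv_mul_eq_div]
  congr 1
  refine sum_congr rfl fun i _ => ?_
  by_cases hi : S i ∈ lossSet U h
  · rw [Set.indicator_of_mem hi]
    exact hi
  · rw [Set.indicator_of_notMem hi, advLoss, if_neg fun hz => hi (mem_lossSet.2 hz)]

theorem setOf_ne_eq_preimage (h : X → Bool) (y : Bool) : {z | h z ≠ y} = h ⁻¹' {!y} := by
  ext z
  cases hz : h z <;> cases y <;> simp [hz]

variable [MeasurableSpace X]

theorem exists_risk_lt {V : Perturbation X} {P : Measure (X × Bool)} {H : Set (X → Bool)}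
    (hH : H.Nonempty) {r : ℝ} (hr : optRisk V P H < r) : ∃ h ∈ H, risk V P h < r := by
  have := hH.to_subtype
  obtain ⟨⟨h, hh⟩, hlt⟩ := exists_lt_of_ciInf_lt hr
  exact ⟨h, hh, hlt⟩

/-- The error probability of `h` at the labelled point `q` under uniform perturbations. -/
def localErr (ν : Measure X) (V : Perturbation X) (h : X → Bool) (q : X × Bool) : ℝ :=
  (unif ν (V q.1)).real {z | h z ≠ q.2}

variable {ν : Measure X} {U V W C : Perturbation X} {η : ℝ} {H : Set (X → Bool)} {h : X → Bool}

/-- The left side is the mass of B ∩ D under the uniform measure on A. -/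
theorem unif_mul_unif_le {A B D : Set X} (hA : AdmitsUniform ν A) (hB : AdmitsUniform ν B)
    (hBA : B ⊆ A) : (unif ν B).real D * (unif ν A).real B ≤ (unif ν A).real D := by
  have hB0 : ν.real B ≠ 0 := (ENNReal.toReal_pos hB.2.1 hB.2.2).ne'
  have hAt : ν (A ∩ D) ≠ ⊤ := ne_top_of_le_ne_top hA.2.2 (measure_mono Set.inter_subset_left)
  have hreal : ∀ {A D : Set X}, MeasurableSet A →
      (unif ν A).real D = (ν.real A)⁻¹ * ν.real (A ∩ D) :=
    fun hA => by
      rw [unif, measureReal_def, ProbabilityTheory.cond_apply hA, ENNReal.toReal_mul,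
        ENNReal.toReal_inv]
      rfl
  rw [hreal hB.1, hreal hA.1, hreal hA.1, Set.inter_eq_right.2 hBA]
  have h1 : ν.real (B ∩ D) ≤ ν.real (A ∩ D) :=
    measureReal_mono (Set.inter_subset_inter_left _ hBA) hAt
  calc (ν.real B)⁻¹ * ν.real (B ∩ D) * ((ν.real A)⁻¹ * ν.real B)
      = (ν.real A)⁻¹ * ν.real (B ∩ D) := by field_simp
    _ ≤ _ := mul_le_mul_of_nonneg_left h1 (inv_nonneg.2 measureReal_nonneg)

theorem half_le_of_smooth_ne (hh : Measurable h) {z : X} {y : Bool} (hW : AdmitsUniform ν (W z))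
    (hz : smooth ν W h z ≠ y) : 1 / 2 ≤ (unif ν (W z)).real {x | h x ≠ y} := by
  have := isProbabilityMeasure_unif hW
  have hA : MeasurableSet {x | h x = true} := hh (MeasurableSet.singleton true)
  have hint : ∫ x', (if h x' = true then (1 : ℝ) else 0) ∂unif ν (W z)
      = (unif ν (W z)).real {x | h x = true} := by
    rw [← integral_indicator_one hA]
    refine integral_congr_ae (Filter.Eventually.of_forall fun x => ?_)
    by_cases hx : h x = true <;> simp [hx]
  simp only [smooth, hint] at hz
  cases y with
  | false =>
    have hset : {x | h x ≠ false} = {x | h x = true} := by ext; simp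
    rw [hset]
    by_contra hcon
    exact hz (if_neg hcon)
  | true =>
    have hset : {x | h x ≠ true} = {x | h x = true}ᶜ := rfl
    rw [hset, probReal_compl_eq_one_sub hA]
    by_contra hcon
    exact hz (if_pos (by linarith))

/-- If the smoothed predictor can be fooled at `q`, then uniform perturbations fool the original one
with probability at least `3 η / 2`. -/
theorem le_localErr_of_mem_lossSet (hV : ∀ x, AdmitsUniform ν (V x))
    (hW : ∀ x, AdmitsUniform ν (W x)) (hWV : ∀ x, ∀ z ∈ U x, W z ⊆ V x)
    (hηW : ∀ x, ∀ z ∈ U x, 3 * η ≤ (unif ν (V x)).real (W z)) (hh : Measurable h)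
    {q : X × Bool} (hq : q ∈ lossSet U (smooth ν W h)) : 3 / 2 * η ≤ localErr ν V h q := by
  obtain ⟨z, hz, hne⟩ := mem_lossSet.1 hq
  have h1 := half_le_of_smooth_ne hh (hW z) hne
  have h2 := unif_mul_unif_le (D := {x | h x ≠ q.2}) (hV q.1) (hW z) (hWV _ z hz)
  have h3 := hηW _ z hz
  refine le_trans ?_ h2
  nlinarith [measureReal_nonneg (μ := unif ν (V q.1)) (s := W z)]

/-- The wrongly labelled points form the preimage of the opposite label, which the net must meet. -/
theorem mem_lossSet_of_le_localErr (hC : IsLocalDiscretization ν H V η C) (hh : h ∈ H)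
    {q : X × Bool} (hq : η ≤ localErr ν V h q) : q ∈ lossSet C h := by
  rw [localErr, setOf_ne_eq_preimage] at hq
  obtain ⟨z, hz, hzC⟩ := (hC.2 q.1).2 h hh _ hq
  rw [← setOf_ne_eq_preimage] at hz
  exact mem_lossSet.2 ⟨z, hzC, hz⟩

variable {T : Type*} [MeasurableSpace T] {e : T → X → Bool} {d : ℕ}

/-- Measurability jointly with the parameter t is what the projection argument requires; it comes
from viewing the uniform measures as a Markov kernel. -/
theorem measurable_localErr (he : Measurable fun q : T × X => e q.1 q.2)
    (hV : ∀ x, AdmitsUniform ν (V x)) (hVm : Measurable fun x => unif ν (V x)) :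
    Measurable fun q : T × (X × Bool) => localErr ν V (e q.1) q.2 := by
  let κ : ProbabilityTheory.Kernel (T × (X × Bool)) X :=
    ⟨fun q => unif ν (V q.2.1), hVm.comp (measurable_fst.comp measurable_snd)⟩
  have : ProbabilityTheory.IsMarkovKernel κ := ⟨fun q => isProbabilityMeasure_unif (hV q.2.1)⟩
  have hs : MeasurableSet {r : (T × (X × Bool)) × X | e r.1.1 r.2 ≠ r.1.2.2} :=
    (measurableSet_eq_fun (he.comp (by fun_prop : Measurable fun r : (T × (X × Bool)) × X =>
      (r.1.1, r.2))) (by fun_prop)).compl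
  exact (ProbabilityTheory.Kernel.measurable_kernel_prodMk_left (κ := κ) hs).ennreal_toReal

theorem localErr_le_add (hV : ∀ x, AdmitsUniform ν (V x)) (h g : X → Bool) (q : X × Bool) :
    localErr ν V h q ≤ localErr ν V g q + (unif ν (V q.1)).real {z | h z ≠ g z} := by
  have := isProbabilityMeasure_unif (hV q.1)
  refine (measureReal_mono (fun z hz => ?_)).trans (measureReal_union_le _ _)
  by_cases hzg : h z = g z
  · exact Or.inl fun hg => hz (hzg.trans hg)
  · exact Or.inr hzg

variable [StandardBorelSpace T]

/-- Uniform deviation of the probabilities and frequencies of large local errors. -/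
theorem measure_exists_localErr_relDev_le (he : Measurable fun q : T × X => e q.1 q.2)
    (hH : vcDim (Set.range e) ≤ d) (hd : d ≠ 0) (hV : ∀ x, AdmitsUniform ν (V x))
    (hVm : Measurable fun x => unif ν (V x)) (hη : 0 < η) (hη1 : η < 1 / 3)
    (P : Measure (X × Bool)) [IsProbabilityMeasure P] {n : ℕ} (hn1 : 1 ≤ n) {τ : ℝ} (hτ : 0 < τ)
    (hn : 32 / τ ≤ n) :
    (Measure.pi fun _ : Fin n => P) {S | ∃ h ∈ Set.range e,
      RelDev τ (hits {q | η ≤ localErr ν V h q} S / n) (P.real {q | 3 / 2 * η ≤ localErr ν V h q})}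
      ≤ ENNReal.ofReal (2 * ((48 * d * n / η) ^ (2 * d) * Real.exp (-(τ * n / 4)))) := by
  classical
  have hm := measurable_localErr he hV hVm
  have := fun x => isProbabilityMeasure_unif (hV x)
  have hn1' : (1 : ℝ) ≤ n := by exact_mod_cast hn1
  simp only [Set.exists_range_iff]
  refine measure_exists_relDev_le P
    (a := {q : T × (X × Bool) | 3 / 2 * η ≤ localErr ν V (e q.1) q.2})
    (b := {q : T × (X × Bool) | η ≤ localErr ν V (e q.1) q.2})
    (measurableSet_le measurable_const hm) (measurableSet_le measurable_const hm) hτ hn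
    fun K hK => ?_
  have hK' : (#(K.image Prod.fst) : ℝ) ≤ 2 * n := by exact_mod_cast card_image_le.trans hK
  obtain ⟨F, hF, hcov⟩ := exists_cover_family hH hd (measurable_section he)
    (fun x => unif ν (V x)) (K.image Prod.fst) (ρ := η / 4) hK' (by positivity) (by linarith)
  -- The threshold is the midpoint of η and 3η/2, so an error of η/4 in either direction is
  -- harmless.
  refine ⟨F.image fun f => {q | 5 / 4 * η ≤ localErr ν V f q}, ?_, fun t => ?_⟩
  · refine (Nat.cast_le.2 card_image_le).trans (hF.trans (le_of_eq ?_))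
    congr 1
    field_simp
    ring
  · obtain ⟨f, hf, hfK⟩ := hcov _ ⟨t, rfl⟩
    refine ⟨_, mem_image_of_mem _ hf, fun q hq => ?_⟩
    have h1 := hfK q.1 (mem_image_of_mem _ hq)
    have h2 := localErr_le_add hV (e t) f q
    have h3 := localErr_le_add hV f (e t) q
    simp only [ne_comm (a := f _)] at h3
    simp only [Set.mem_ofPred_eq]
    exact ⟨fun _ => by linarith, fun _ => by linarith⟩

end Losses

/-! ### Sample sizes -/

section Rates

/-- The number of samples that suffices for a relative deviation of order `ε`. -/
def sampleSize (d : ℕ) (η ε δ : ℝ) : ℕ :=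
  ⌈256 / ε * (2 * d * Real.log (512 * d / ε) + 2 * d * Real.log (48 * d / η) + Real.log (4 / δ))
    + 1024 / ε⌉₊

/-- As η < 1/3 < 1/e, the logarithm of d/η is at least 1; so d, and every absolute constant, is
absorbed by `complexity`. -/
theorem le_mul_log_and_log_nonneg {d : ℕ} (hd : d ≠ 0) {η δ : ℝ} (hη : 0 < η) (hη1 : η < 1 / 3)
    (hδ : δ ∈ Set.Ioo (0 : ℝ) 1) :
    (d : ℝ) ≤ d * Real.log (d / η) ∧ 0 ≤ Real.log (1 / δ) := by
  have hd1 : (1 : ℝ) ≤ d := by exact_mod_cast Nat.one_le_iff_ne_zero.2 hd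
  refine ⟨le_mul_of_one_le_right (by linarith) ?_, Real.log_nonneg ?_⟩
  · rw [Real.le_log_iff_exp_le (by positivity), le_div_iff₀ hη]
    have := Real.exp_one_lt_d9
    nlinarith
  · rw [le_div_iff₀ hδ.1]
    linarith [hδ.2]

/-- Only log(512d/ε) exceeds the complexity term. Since d/ε ≤ f it is at most 7 + log(1 + f), which
accounts for the single logarithmic factor. -/
theorem sampleSize_le {d : ℕ} (hd : d ≠ 0) {η ε δ : ℝ} (hη : 0 < η) (hη1 : η < 1 / 3)
    (hε : ε ∈ Set.Ioo (0 : ℝ) 1) (hδ : δ ∈ Set.Ioo (0 : ℝ) 1) :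
    (sampleSize d η ε δ : ℝ) ≤ softBound 10000 1 (complexity d η δ / ε) := by
  obtain ⟨hε0, hε1⟩ := hε
  obtain ⟨hd2, hδ2⟩ := le_mul_log_and_log_nonneg hd hη hη1 hδ
  have hd1 : (1 : ℝ) ≤ d := by exact_mod_cast Nat.one_le_iff_ne_zero.2 hd
  have hlog2 := Real.log_two_lt_d9
  have hlog2' := Real.log_two_gt_d9
  set G := complexity d η δ with hG
  have hGeq : G = d * Real.log (d / η) + Real.log (1 / δ) := rfl
  have hdG : (d : ℝ) ≤ G := by linarith
  have hG1 : 1 ≤ G := by linarith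
  set f := G / ε with hf
  have hf1 : 1 ≤ f := by rw [hf, le_div_iff₀ hε0]; linarith
  set l := Real.log (1 + f) with hl
  have hl0 : 0 ≤ l := Real.log_nonneg (by linarith)
  have h512 : Real.log (512 * d / ε) ≤ 7 + l := by
    have h1 : 512 * d / ε ≤ 512 * (1 + f) := by
      rw [mul_div_assoc]
      have : d / ε ≤ f := div_le_div_of_nonneg_right hdG hε0.le
      linarith
    have h2 : Real.log 512 ≤ 7 := by
      rw [show (512 : ℝ) = 2 ^ 9 by norm_num, Real.log_pow]
      norm_num
      linarith
    calc Real.log (512 * d / ε) ≤ Real.log (512 * (1 + f)) := Real.log_le_log (by positivity) h1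
      _ = Real.log 512 + l := Real.log_mul (by norm_num) (by linarith)
      _ ≤ 7 + l := by linarith
  have h48 : Real.log (48 * d / η) ≤ 5 + Real.log (d / η) := by
    have h2 : Real.log 48 ≤ 5 := by
      refine (Real.log_le_log (by norm_num) (show (48 : ℝ) ≤ 2 ^ 6 by norm_num)).trans ?_
      rw [Real.log_pow]
      norm_num
      linarith
    rw [mul_div_assoc, Real.log_mul (by norm_num) (by positivity)]
    linarith
  have h4 : Real.log (4 / δ) ≤ 2 + Real.log (1 / δ) := by
    have h2 : Real.log 4 ≤ 2 := by
      rw [show (4 : ℝ) = 2 ^ 2 by norm_num, Real.log_pow]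
      norm_num
      linarith
    rw [show 4 / δ = 4 * (1 / δ) by ring, Real.log_mul (by norm_num)
      (one_div_ne_zero hδ.1.ne')]
    linarith
  have hsum : 2 * d * Real.log (512 * d / ε) + 2 * d * Real.log (48 * d / η) + Real.log (4 / δ)
      ≤ 29 * G * (1 + l) := by
    have e1 : 2 * d * Real.log (512 * d / ε) ≤ 2 * G * (7 + l) :=
      mul_le_mul (by linarith) h512 (Real.log_nonneg (by
        rw [le_div_iff₀ hε0]; linarith)) (by linarith)
    have e2 : 2 * d * Real.log (48 * d / η) ≤ 2 * d * (5 + Real.log (d / η)) :=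
      mul_le_mul_of_nonneg_left h48 (by linarith)
    nlinarith
  have hceil := (Nat.ceil_lt_add_one (a := 256 / ε * (2 * d * Real.log (512 * d / ε)
    + 2 * d * Real.log (48 * d / η) + Real.log (4 / δ)) + 1024 / ε) ?_).le
  · refine hceil.trans ?_
    have h1 : 256 / ε * (2 * d * Real.log (512 * d / ε) + 2 * d * Real.log (48 * d / η)
        + Real.log (4 / δ)) ≤ 7424 * f * (1 + l) := by
      calc _ ≤ 256 / ε * (29 * G * (1 + l)) := mul_le_mul_of_nonneg_left hsum (by positivity)
        _ = _ := by rw [hf]; ring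
    have h2 : 1024 / ε ≤ 1024 * f := by
      rw [hf, ← mul_div_assoc]
      exact div_le_div_of_nonneg_right (by linarith) hε0.le
    have h3 : 0 ≤ f * l := by positivity
    rw [softBound, pow_one]
    nlinarith
  · have e1 : 0 ≤ Real.log (512 * d / ε) :=
      Real.log_nonneg (by rw [le_div_iff₀ hε0]; linarith)
    have e2 : 0 ≤ Real.log (48 * d / η) :=
      Real.log_nonneg (by rw [le_div_iff₀ hη]; linarith)
    have e3 : 0 ≤ Real.log (4 / δ) :=
      Real.log_nonneg (by rw [le_div_iff₀ hδ.1]; linarith [hδ.2])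
    positivity

theorem deviation_le_of_sampleSize_le {d : ℕ} (hd : d ≠ 0) {η ε δ : ℝ} (hη : 0 < η)
    (hη1 : η < 1 / 3) (hε : 0 < ε) (hε1 : ε < 1) (hδ : δ ∈ Set.Ioo (0 : ℝ) 1) {n : ℕ}
    (hn : sampleSize d η ε δ ≤ n) :
    1 ≤ n ∧ 32 / (ε / 32) ≤ n ∧
      2 * ((48 * d * n / η) ^ (2 * d) * Real.exp (-(ε / 32 * n / 4))) ≤ δ / 2 ∧
      2 * (1 * Real.exp (-(ε / 32 * n / 4))) ≤ δ / 2 := by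
  have hd1 : (1 : ℝ) ≤ d := by exact_mod_cast Nat.one_le_iff_ne_zero.2 hd
  have e1 : 0 ≤ Real.log (512 * d / ε) :=
    Real.log_nonneg (by rw [le_div_iff₀ hε]; linarith)
  have e2 : 0 ≤ Real.log (48 * d / η) :=
    Real.log_nonneg (by rw [le_div_iff₀ hη]; linarith)
  have e3 : 0 ≤ Real.log (4 / δ) :=
    Real.log_nonneg (by rw [le_div_iff₀ hδ.1]; linarith [hδ.2])
  have hn' := Nat.ceil_le.1 hn
  set G := 2 * d * Real.log (512 * d / ε) + 2 * d * Real.log (48 * d / η) + Real.log (4 / δ)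
  have hG : 0 ≤ G := by positivity
  have h32 : 32 / (ε / 32) = 1024 / ε := by field_simp; norm_num
  have hnε : 1024 / ε ≤ n := le_trans (le_add_of_nonneg_left (by positivity)) hn'
  have hn1 : (1 : ℝ) ≤ n := by
    refine le_trans ?_ hnε
    rw [le_div_iff₀ hε]
    linarith
  have hGn : 256 * G ≤ ε * n := by
    have : 256 / ε * G ≤ n := le_trans (le_add_of_nonneg_right (by positivity)) hn'
    rw [div_mul_eq_mul_div, div_le_iff₀ hε] at this
    linarith
  have hbase : 1 ≤ 48 * d * n / η := by
    rw [le_div_iff₀ hη]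
    nlinarith
  have hmain : 2 * ((48 * d * n / η) ^ (2 * d) * Real.exp (-(ε / 32 * n / 4))) ≤ δ / 2 := by
    -- The tangent bound for the logarithm is scaled so that the 2d log n from the covering number
    -- uses up half of the exponent εn/128; the other half pays for G.
    have hlogn : Real.log n ≤ ε * n / (512 * d) + Real.log (512 * d / ε) := by
      have h1 : Real.log n = Real.log (ε * n / (512 * d)) + Real.log (512 * d / ε) := by
        rw [← Real.log_mul (by positivity) (by positivity)]
        congr 1
        field_simp
      rw [h1]
      have := Real.log_le_sub_one_of_pos (show 0 < ε * n / (512 * d) by positivity)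
      linarith
    have hpow : (48 * d * n / η) ^ (2 * d)
        = Real.exp (2 * d * (Real.log (48 * d / η) + Real.log n)) := by
      rw [← Real.log_mul (by positivity) (by positivity),
        show 48 * d / η * (n : ℝ) = 48 * d * n / η by ring]
      rw [show 2 * (d : ℝ) * Real.log (48 * d * n / η)
        = (2 * d : ℕ) * Real.log (48 * d * n / η) by push_cast; ring, Real.exp_nat_mul,
        Real.exp_log (by positivity)]
    have hexp : 2 * d * (Real.log (48 * d / η) + Real.log n) + -(ε / 32 * n / 4)
        ≤ -Real.log (4 / δ) := by
      have h1 : 2 * d * Real.log n ≤ ε * n / 256 + 2 * d * Real.log (512 * d / ε) := by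
        calc 2 * d * Real.log n ≤ 2 * d * (ε * n / (512 * d) + Real.log (512 * d / ε)) :=
              mul_le_mul_of_nonneg_left hlogn (by positivity)
          _ = _ := by field_simp; ring
      simp only [G] at hGn
      linarith
    rw [hpow, ← Real.exp_add]
    have h2 := Real.exp_le_exp.2 hexp
    rw [Real.exp_neg, Real.exp_log (div_pos (by norm_num) hδ.1), inv_div] at h2
    linarith
  refine ⟨by exact_mod_cast hn1, h32 ▸ hnε, hmain, le_trans ?_ hmain⟩
  gcongr
  exact one_le_pow₀ hbase

end Rates

/-! ### Learning guarantees -/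

section Learning

variable {X : Type*} {H : Set (X → Bool)}

theorem eq_of_vcDim_le_zero {H : Set (X → Bool)} (hH : vcDim H ≤ (0 : ℕ)) {f g : X → Bool}
    (hf : f ∈ H) (hg : g ∈ H) : f = g := by
  classical
  by_contra hne
  obtain ⟨x, hx⟩ := Function.ne_iff.1 hne
  have hsh : Shatters H {x} := fun y => by
    by_cases h : f x = y x
    · exact ⟨f, hf, by simpa using h⟩
    · refine ⟨g, hg, ?_⟩
      simp only [Finset.mem_singleton, forall_eq]
      cases hfx : f x <;> cases hgx : g x <;> cases hyx : y x <;> simp_all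
  simpa using card_le_of_shatters hH hsh

/-- The frequency of a fixed event rarely exceeds its probability. -/
theorem measure_lt_hits_le {Z : Type*} [MeasurableSpace Z] (P : Measure Z) [IsProbabilityMeasure P]
    {D : Set Z} (hD : MeasurableSet D) {n : ℕ} (hn1 : 1 ≤ n) {s : ℝ} (hs : 0 < s)
    (hn : 32 / (s ^ 2 / 2) ≤ n) :
    (Measure.pi fun _ : Fin n => P) {S | P.real D + s < hits D S / n}
      ≤ ENNReal.ofReal (2 * (1 * Real.exp (-(s ^ 2 / 2 * n / 4)))) := by
  -- The deviation bound controls frequencies from below, so it is applied to the complement, with a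
  -- one-point parameter space. Probability and frequency add up to at most 2, so a gap s is a
  -- relative deviation of level s²/2.
  have ha : MeasurableSet {q : Unit × Z | q.2 ∈ Dᶜ} := measurable_snd hD.compl
  refine le_trans (measure_mono ?_) (measure_exists_relDev_le P ha ha (M := 1) (by positivity) hn
    fun K _ => ⟨{Dᶜ}, by simp, fun t => ⟨Dᶜ, by simp, fun z _ => ⟨id, id⟩⟩⟩)
  intro S hS
  have hn' : (0 : ℝ) < n := by exact_mod_cast hn1
  change P.real D + s < hits D S / n at hS
  refine ⟨(), ?_⟩
  change RelDev (s ^ 2 / 2) (hits Dᶜ S / n) (P.real Dᶜ)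
  rw [hits_compl, probReal_compl_eq_one_sub hD, sub_div, div_self hn'.ne']
  have h1 : P.real D ≤ 1 := measureReal_le_one
  have h2 : 0 ≤ P.real D := measureReal_nonneg
  have h3 : 0 ≤ hits D S / n := div_nonneg (hits_nonneg _ _) hn'.le
  refine ⟨by linarith, ?_⟩
  calc s ^ 2 / 2 * (1 - P.real D + (1 - hits D S / n)) ≤ s ^ 2 / 2 * 2 := by
        gcongr
        linarith
    _ = s ^ 2 := by ring
    _ ≤ _ := by
      refine pow_le_pow_left₀ hs.le ?_ 2
      linarith

variable [MeasurableSpace X] {ν : Measure X} {U V W C : Perturbation X} {η : ℝ}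

theorem hits_localErr_le (hC : IsLocalDiscretization ν (H) V η C) {h : X → Bool}
    (hh : h ∈ H) {n : ℕ} (S : Fin n → X × Bool) :
    hits {q | η ≤ localErr ν V h q} S / n ≤ empRisk C S h := by
  rw [empRisk_eq_hits]
  exact div_le_div_of_nonneg_right
    (hits_le_hits fun i hi => mem_lossSet_of_le_localErr hC hh hi) (Nat.cast_nonneg n)

variable {T : Type*} [MeasurableSpace T] [StandardBorelSpace T] {e : T → X → Bool} {d : ℕ}

/-- With high probability some hypothesis has no V-loss on the sample, so the oracle attains
empirical C-loss 0. Against frequency 0 a relative deviation of level ε/32 only asks for probability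
at least ε/32, hence the rate 1/ε. -/
theorem tolerantlyLearns_realizable (he : Measurable fun q : T × X => e q.1 q.2)
    (hne : (Set.range e).Nonempty) (hH : vcDim (Set.range e) ≤ d) (hd : d ≠ 0) (hη : 0 < η)
    (hη1 : η < 1 / 3) (hV : ∀ x, AdmitsUniform ν (V x)) (hW : ∀ x, AdmitsUniform ν (W x))
    (hVm : Measurable fun x => unif ν (V x)) (hWV : ∀ x, ∀ z ∈ U x, W z ⊆ V x)
    (hηW : ∀ x, ∀ z ∈ U x, 3 * η ≤ (unif ν (V x)).real (W z))
    (hC : IsLocalDiscretization ν (Set.range e) V η C) {A : Learner X}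
    (hA : IsRERM (Set.range e) C A) :
    TolerantlyLearns U V (Set.range e) (realizable V (Set.range e)) (rermAndSmooth ν W A)
      (sampleSize d η) := by
  rintro P ⟨hP, hopt⟩ ε hε δ hδ n hn
  obtain ⟨hn1, hn2, hdev, -⟩ := deviation_le_of_sampleSize_le hd hη hη1 hε.1 hε.2 hδ hn
  have hn1' : (0 : ℝ) < n := by exact_mod_cast hn1
  -- The infimum 0 need not be attained; a hypothesis of risk below δ/(2n) errs on one of the n
  -- points with probability at most δ/2.
  set γ := δ / 2 / n with hγ
  have hγ0 : 0 < γ := div_pos (half_pos hδ.1) hn1'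
  obtain ⟨h, hh, hrisk⟩ := exists_risk_lt hne (hopt.trans_lt hγ0)
  set B := {S : Fin n → X × Bool | ∃ h ∈ Set.range e, RelDev (ε / 32)
    (hits {q | η ≤ localErr ν V h q} S / n) (P.real {q | 3 / 2 * η ≤ localErr ν V h q})}
  have hB : (Measure.pi fun _ : Fin n => P) B ≤ ENNReal.ofReal (δ / 2) :=
    (measure_exists_localErr_relDev_le he hH hd hV hVm hη hη1 P hn1 (by linarith [hε.1]) hn2).trans
      (ENNReal.ofReal_le_ofReal hdev)
  have hN : (Measure.pi fun _ : Fin n => P) (⋃ i, Function.eval i ⁻¹' lossSet V h)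
      ≤ ENNReal.ofReal (δ / 2) := by
    refine (measure_iUnion_fintype_le _ _).trans ?_
    have h1 : ∀ i : Fin n, (Measure.pi fun _ : Fin n => P) (Function.eval i ⁻¹' lossSet V h)
        ≤ ENNReal.ofReal γ := by
      intro i
      set D := toMeasurable P (lossSet V h)
      calc (Measure.pi fun _ : Fin n => P) (Function.eval i ⁻¹' lossSet V h)
          ≤ (Measure.pi fun _ : Fin n => P) (Function.eval i ⁻¹' D) :=
            measure_mono (Set.preimage_mono (subset_toMeasurable _ _))
        _ = P (lossSet V h) := by
            rw [(measurePreserving_eval (fun _ : Fin n => P) i).measure_preimage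
              (measurableSet_toMeasurable _ _).nullMeasurableSet, measure_toMeasurable]
        _ ≤ ENNReal.ofReal γ :=
            (ENNReal.le_ofReal_iff_toReal_le (measure_ne_top _ _) hγ0.le).2 hrisk.le
    refine (Finset.sum_le_sum fun i _ => h1 i).trans (le_of_eq ?_)
    rw [Finset.sum_const, nsmul_eq_mul, Finset.card_univ, Fintype.card_fin, ← ENNReal.ofReal_natCast,
      ← ENNReal.ofReal_mul hn1'.le, hγ, mul_div_cancel₀ _ hn1'.ne']
  have hcover : {S | ¬ risk U P (rermAndSmooth ν W A n S) ≤ optRisk V P (Set.range e) + ε}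
      ⊆ B ∪ ⋃ i, Function.eval i ⁻¹' lossSet V h := by
    intro S hS
    by_contra hcon
    rw [Set.mem_union, not_or] at hcon
    obtain ⟨hSB, hSN⟩ := hcon
    refine hS ?_
    by_contra! hlt
    rw [hopt, zero_add] at hlt
    refine hSB ⟨A n S, (hA n S).1, ?_⟩
    have hp : ε < P.real {q | 3 / 2 * η ≤ localErr ν V (A n S) q} :=
      hlt.trans_le (measureReal_mono fun q hq =>
        le_localErr_of_mem_lossSet hV hW hWV hηW (measurable_section he _ (hA n S).1) hq)
    have hzero : empRisk V S h = 0 := by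
      rw [empRisk_eq_hits, hits, Finset.sum_eq_zero, zero_div]
      intro i _
      have hi : S i ∉ lossSet V h := fun hi => hSN (Set.mem_iUnion.2 ⟨i, hi⟩)
      exact Set.indicator_of_notMem hi _
    have hCV : empRisk C S h ≤ empRisk V S h := by
      rw [empRisk_eq_hits, empRisk_eq_hits]
      exact div_le_div_of_nonneg_right (hits_le_hits fun i hi => lossSet_mono hC.1 h hi) hn1'.le
    have hq : hits {q | η ≤ localErr ν V (A n S) q} S / n = 0 :=
      le_antisymm ((hits_localErr_le hC (hA n S).1 S).trans
        (((hA n S).2 h hh).trans (hCV.trans hzero.le)))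
        (div_nonneg (hits_nonneg _ _) hn1'.le)
    rw [hq]
    refine ⟨hε.1.trans hp, ?_⟩
    rw [add_zero, sub_zero, sq]
    exact mul_le_mul_of_nonneg_right (by linarith [hε.1]) measureReal_nonneg
  calc _ ≤ _ := measure_mono hcover
    _ ≤ _ := measure_union_le _ _
    _ ≤ ENNReal.ofReal (δ / 2) + ENNReal.ofReal (δ / 2) := add_le_add hB hN
    _ = ENNReal.ofReal δ := by
      rw [← ENNReal.ofReal_add (half_pos hδ.1).le (half_pos hδ.1).le, add_halves]

/-- A fixed hypothesis within ε/4 of the optimum has frequency within another ε/4 of its risk, and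
the oracle does no worse. Excess risk above ε thus forces a gap of ε/2, a relative deviation of
level ε²/32. -/
theorem tolerantlyLearns_agnostic (he : Measurable fun q : T × X => e q.1 q.2)
    (hne : (Set.range e).Nonempty) (hH : vcDim (Set.range e) ≤ d) (hd : d ≠ 0) (hη : 0 < η)
    (hη1 : η < 1 / 3) (hV : ∀ x, AdmitsUniform ν (V x)) (hW : ∀ x, AdmitsUniform ν (W x))
    (hVm : Measurable fun x => unif ν (V x)) (hWV : ∀ x, ∀ z ∈ U x, W z ⊆ V x)
    (hηW : ∀ x, ∀ z ∈ U x, 3 * η ≤ (unif ν (V x)).real (W z))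
    (hC : IsLocalDiscretization ν (Set.range e) V η C) {A : Learner X}
    (hA : IsRERM (Set.range e) C A) :
    TolerantlyLearns U V (Set.range e) (agnostic X) (rermAndSmooth ν W A)
      (fun ε => sampleSize d η (ε ^ 2)) := by
  intro P hP ε hε δ hδ n hn
  have : IsProbabilityMeasure P := hP
  obtain ⟨hε0, hε1⟩ := hε
  obtain ⟨hn1, hn2, hdev, hdev1⟩ := deviation_le_of_sampleSize_le hd hη hη1
    (by positivity : 0 < ε ^ 2) (by nlinarith) hδ hn
  have hn1' : (0 : ℝ) < n := by exact_mod_cast hn1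
  obtain ⟨h, hh, hrisk⟩ := exists_risk_lt (V := V) (P := P) hne
    (lt_add_of_pos_right (optRisk V P (Set.range e)) (show 0 < ε / 4 by positivity))
  set B := {S : Fin n → X × Bool | ∃ h ∈ Set.range e, RelDev (ε ^ 2 / 32)
    (hits {q | η ≤ localErr ν V h q} S / n) (P.real {q | 3 / 2 * η ≤ localErr ν V h q})}
  have hB : (Measure.pi fun _ : Fin n => P) B ≤ ENNReal.ofReal (δ / 2) :=
    (measure_exists_localErr_relDev_le he hH hd hV hVm hη hη1 P hn1 (by positivity) hn2).trans
      (ENNReal.ofReal_le_ofReal hdev)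
  set D := toMeasurable P (lossSet V h)
  have hDrisk : P.real D = risk V P h := by
    rw [measureReal_def, measure_toMeasurable]
    rfl
  have hsq : (ε / 4) ^ 2 / 2 = ε ^ 2 / 32 := by ring
  have hN : (Measure.pi fun _ : Fin n => P) {S | P.real D + ε / 4 < hits D S / n}
      ≤ ENNReal.ofReal (δ / 2) := by
    refine (measure_lt_hits_le P (measurableSet_toMeasurable _ _) hn1
      (by positivity : 0 < ε / 4) (by rwa [hsq])).trans (ENNReal.ofReal_le_ofReal ?_)
    rwa [hsq]
  have hcover : {S | ¬ risk U P (rermAndSmooth ν W A n S) ≤ optRisk V P (Set.range e) + ε}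
      ⊆ B ∪ {S | P.real D + ε / 4 < hits D S / n} := by
    intro S hS
    by_contra hcon
    rw [Set.mem_union, not_or, Set.mem_ofPred_eq (p := fun S => _ < hits D S / _), not_lt] at hcon
    obtain ⟨hSB, hSN⟩ := hcon
    refine hS ?_
    by_contra! hlt
    refine hSB ⟨A n S, (hA n S).1, ?_⟩
    have hp : risk U P (rermAndSmooth ν W A n S)
        ≤ P.real {q | 3 / 2 * η ≤ localErr ν V (A n S) q} :=
      measureReal_mono fun q hq =>
        le_localErr_of_mem_lossSet hV hW hWV hηW (measurable_section he _ (hA n S).1) hq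
    have hCD : empRisk C S h ≤ hits D S / n := by
      rw [empRisk_eq_hits]
      exact div_le_div_of_nonneg_right (hits_le_hits fun i hi =>
        subset_toMeasurable _ _ (lossSet_mono hC.1 h hi)) hn1'.le
    have hq := (hits_localErr_le hC (hA n S).1 S).trans (((hA n S).2 h hh).trans (hCD.trans hSN))
    rw [hDrisk] at hq
    set p := P.real {q | 3 / 2 * η ≤ localErr ν V (A n S) q}
    set v := hits {q | η ≤ localErr ν V (A n S) q} S / n
    have hp1 : p ≤ 1 := measureReal_le_one
    have hgap : ε / 2 ≤ p - v := by linarith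
    refine ⟨by linarith, ?_⟩
    calc ε ^ 2 / 32 * (p + v) ≤ ε ^ 2 / 32 * 2 := by
          gcongr
          linarith
      _ ≤ (ε / 2) ^ 2 := by nlinarith
      _ ≤ (p - v) ^ 2 := pow_le_pow_left₀ (by positivity) hgap 2
  calc _ ≤ _ := measure_mono hcover
    _ ≤ _ := measure_union_le _ _
    _ ≤ ENNReal.ofReal (δ / 2) + ENNReal.ofReal (δ / 2) := add_le_add hB hN
    _ = ENNReal.ofReal δ := by
      rw [← ENNReal.ofReal_add (half_pos hδ.1).le (half_pos hδ.1).le, add_halves]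

/-- A class of VC-dimension `0` is learned without samples. -/
theorem tolerantlyLearns_of_vcDim_le_zero (hHm : ∀ h ∈ H, Measurable h)
    (hH : vcDim H ≤ (0 : ℕ)) (hη : 0 < η) (hV : ∀ x, AdmitsUniform ν (V x))
    (hW : ∀ x, AdmitsUniform ν (W x)) (hWV : ∀ x, ∀ z ∈ U x, W z ⊆ V x)
    (hηW : ∀ x, ∀ z ∈ U x, 3 * η ≤ (unif ν (V x)).real (W z)) {A : Learner X}
    (hA : IsRERM H C A) {D : Set (Measure (X × Bool))} (hD : ∀ P ∈ D, IsProbabilityMeasure P) :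
    TolerantlyLearns U V H D (rermAndSmooth ν W A) fun _ _ => 0 := by
  intro P hPD ε hε δ _ n _
  have := hD P hPD
  have hempty : {S | ¬ risk U P (rermAndSmooth ν W A n S) ≤ optRisk V P H + ε} = ∅ := by
    refine Set.eq_empty_of_forall_notMem fun S hS => hS ?_
    have hAH := (hA n S).1
    have hle : risk U P (rermAndSmooth ν W A n S) ≤ risk V P (A n S) := by
      refine measureReal_mono fun q hq => ?_
      have h1 := le_localErr_of_mem_lossSet hV hW hWV hηW (hHm _ hAH) hq
      have := isProbabilityMeasure_unif (hV q.1)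
      by_contra hcon
      -- No net is needed here: positive local error already exhibits a wrongly labelled point of
      -- V(x).
      have h2 : localErr ν V (A n S) q = 0 := by
        rw [localErr, measureReal_eq_zero_iff]
        refine measure_eq_zero_iff_ae_notMem.2 ?_
        filter_upwards [(ProbabilityTheory.ae_cond_mem (hV q.1).1 :
          ∀ᵐ z ∂unif ν (V q.1), z ∈ V q.1)] with z hz hzne
        exact hcon (mem_lossSet.2 ⟨z, hz, hzne⟩)
      linarith
    have : Nonempty H := ⟨⟨_, hAH⟩⟩
    have hopt : risk V P (A n S) ≤ optRisk V P H :=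
      le_ciInf fun h => by rw [eq_of_vcDim_le_zero hH hAH h.2]
    linarith [hε.1]
  rw [hempty, measure_empty]
  exact zero_le

end Learning

end TolerantLearning

end

/-! ### The main theorem -/

open TolerantLearning in
theorem mainTheorem3 :
    ∃ (K : ℝ) (p : ℕ), ∀ (X : Type*) [MeasurableSpace X] (ν : MeasureTheory.Measure X)
      (H : Set (X → Bool)) (d : ℕ) (η : ℝ) (U V W : Perturbation X),
      H.Nonempty → MeasurablyParametrized H → vcDim H = (d : ℕ∞) →
      0 < η → η < 1 / 3 →
      (∀ x, AdmitsUniform ν (V x)) → (∀ x, AdmitsUniform ν (W x)) →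
      Measurable (fun x => unif ν (V x)) →
      Contained U V →
      (∀ x, ∀ z ∈ U x, W z ⊆ V x) →
      (∀ x, ∀ z ∈ U x, 3 * η ≤ (unif ν (V x)).real (W z)) →
      -- every local discretization yields a tolerant learner in both settings
      (∀ C : Perturbation X, IsLocalDiscretization ν H V η C →
        (∃ m : ℝ → ℝ → ℕ, ∀ A : Learner X, IsRERM H C A →
          TolerantlyLearns U V H (realizable V H) (rermAndSmooth ν W A) m) ∧
        (∃ n : ℝ → ℝ → ℕ, ∀ A : Learner X, IsRERM H C A →
          TolerantlyLearns U V H (agnostic X) (rermAndSmooth ν W A) n)) ∧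
      -- and one can be chosen so that the stated rates hold
      (∃ C : Perturbation X, IsLocalDiscretization ν H V η C ∧
        ∃ m n : ℝ → ℝ → ℕ,
          (∀ ε ∈ Set.Ioo (0 : ℝ) 1, ∀ δ ∈ Set.Ioo (0 : ℝ) 1,
            (m ε δ : ℝ) ≤ softBound K p (complexity d η δ / ε) ∧
            (n ε δ : ℝ) ≤ softBound K p (complexity d η δ / ε ^ 2)) ∧
          ∀ A : Learner X, IsRERM H C A →
            TolerantlyLearns U V H (realizable V H) (rermAndSmooth ν W A) m ∧
            TolerantlyLearns U V H (agnostic X) (rermAndSmooth ν W A) n) := by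
  refine ⟨10000, 1, ?_⟩
  rintro X _ ν H d η U V W hne ⟨T, _, _, e, he, rfl⟩ hd hη hη1 hV hW hVm - hWV hηW
  -- The sample sizes are fixed before C, so the stated rates hold for every local discretization.
  obtain ⟨m, n, hmn, hlearn⟩ : ∃ m n : ℝ → ℝ → ℕ,
      (∀ ε ∈ Set.Ioo (0 : ℝ) 1, ∀ δ ∈ Set.Ioo (0 : ℝ) 1,
        (m ε δ : ℝ) ≤ softBound 10000 1 (complexity d η δ / ε) ∧
        (n ε δ : ℝ) ≤ softBound 10000 1 (complexity d η δ / ε ^ 2)) ∧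
      ∀ C : Perturbation X, IsLocalDiscretization ν (Set.range e) V η C →
        ∀ A : Learner X, IsRERM (Set.range e) C A →
          TolerantlyLearns U V (Set.range e) (realizable V (Set.range e)) (rermAndSmooth ν W A) m ∧
          TolerantlyLearns U V (Set.range e) (agnostic X) (rermAndSmooth ν W A) n := by
    -- For d = 0 the complexity log(1/δ) tends to 0 as δ tends to 1, so no positive constant can be
    -- absorbed. The class is then a single function, and zero samples suffice.
    rcases eq_or_ne d 0 with rfl | hd0
    · refine ⟨fun _ _ => 0, fun _ _ => 0, fun ε hε δ hδ => ?_, fun C _ A hA =>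
        ⟨tolerantlyLearns_of_vcDim_le_zero (measurable_section he) hd.le hη hV hW hWV hηW hA
          fun P hP => hP.1, tolerantlyLearns_of_vcDim_le_zero (measurable_section he) hd.le hη hV hW
          hWV hηW hA fun P hP => hP⟩⟩
      have hsoft : ∀ r : ℝ, 0 < r → 0 ≤ softBound 10000 1 (complexity 0 η δ / r) := fun r hr => by
        have h1 : 0 ≤ complexity 0 η δ := by
          simp only [complexity, Nat.cast_zero, zero_mul, zero_add]
          exact Real.log_nonneg (by rw [le_div_iff₀ hδ.1]; linarith [hδ.2])
        have h2 : 0 ≤ complexity 0 η δ / r := div_nonneg h1 hr.le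
        have h3 : 0 ≤ Real.log (1 + complexity 0 η δ / r) := Real.log_nonneg (by linarith)
        rw [softBound]
        positivity
      simp only [Nat.cast_zero]
      exact ⟨hsoft ε hε.1, hsoft (ε ^ 2) (pow_pos hε.1 2)⟩
    · refine ⟨sampleSize d η, fun ε => sampleSize d η (ε ^ 2), fun ε hε δ hδ =>
        ⟨sampleSize_le hd0 hη hη1 hε hδ, sampleSize_le hd0 hη hη1
          ⟨pow_pos hε.1 2, pow_lt_one₀ hε.1.le hε.2 two_ne_zero⟩ hδ⟩, fun C hC A hA =>
        ⟨tolerantlyLearns_realizable he hne hd.le hd0 hη hη1 hV hW hVm hWV hηW hC hA,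
          tolerantlyLearns_agnostic he hne hd.le hd0 hη hη1 hV hW hVm hWV hηW hC hA⟩⟩
  obtain ⟨C, hC⟩ := exists_isLocalDiscretization he hd.le hV hη
  exact ⟨fun C hC => ⟨⟨m, fun A hA => (hlearn C hC A hA).1⟩, ⟨n, fun A hA => (hlearn C hC A hA).2⟩⟩,
    C, hC, m, n, hmn, fun A hA => hlearn C hC A hA⟩
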